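/- Setting. Let $n\ge 2$ and let $\mathcal N$ be the set of $C^\infty$ ovals with $n$-fold symmetry: closed plane curves $\Gamma$ with positive curvature, traversed once, parametrized by the angle $\varphi$ of the oriented tangent (so $\Gamma'(\varphi)=R(\varphi)e^{i\varphi}$ with $R>0$, identifying the plane with $\mathbb C$) and invariant under the rotation by $2\pi/n$ about the origin. The support function of $\Gamma$ is $g(\varphi)=\langle\Gamma(\varphi),-ie^{i\varphi}\rangle$. The billiard map is $T(\varphi,\alpha)=(\varphi_1,\alpha_1)$, where the ray from $\Gamma(\varphi)$ at angle $\alpha\in(0,\pi)$ with the tangent meets $\Gamma$ again at $\Gamma(\varphi_1)$, $\varphi<\varphi_1<\varphi+2\pi$, and $\alpha_1=\varphi_1-\varphi-\alpha$ is the angle after reflection. For $1\le m\le n-1$ let $T_m(\varphi,\alpha)=T(\varphi,\alpha)-(2\pi m/n,0)$ (the lift, near $\alpha=\alpha_m$, of the map induced by $T$ on the quotient by the rotation by $2\pi/n$), where $\alpha_m=\pi m/n$. A fixed point is elliptic if the eigenvalues of the derivative there are non-real of modulus one, and non-resonant if no eigenvalue $\lambda$ satisfies $\lambda^j=1$ for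 some $j\in\{1,2,3,4\}$. With the canonical variables $s$ (arclength, $ds=R\,d\varphi$) and $p=\cos\alpha$, the twist coefficient (first Birkhoff coefficient) of a non-resonant elliptic fixed point is the real number $\tau$ for which some local $C^\infty$ change of variables $z=\Psi(s,p)\in\mathbb C$, sending the fixed point to $0$ with Jacobian determinant $1$ there, brings the map into the form $z\mapsto e^{i(\zeta+\tau|z|^2)}z+O(|z|^4)$. Statement. Let $\Gamma\in\mathcal N$ have support function $g$, let $1\le m\le n-1$ and $\varphi_0\in\mathbb R$, and suppose that $(\varphi_0,\alpha_m)$ is a non-resonant elliptic fixed point of the map $T_m$ of $\Gamma$ with twist coefficient $0$. Then there are $0<\delta_1<\delta_2<\pi/n$ with $g'(\varphi)\ne0$ for $0<|\varphi-\varphi_0|<\delta_2$, and an even $C^\infty$ function $\rho:\mathbb R\to\mathbb R$ with $\rho(x)=1$ for $|x|<\delta_1$, $\rho(x)=0$ for $|x|>\delta_2$ and $0<-\rho'(x)<C$ for $\delta_1<x<\delta_2$ and some constant $C$, such that the following holds. For every $k\in\mathbb N$ and $\delta>0$ there is $\varepsilon_0>0$ such that for every real $\varepsilon$ with $0<|\varepsilon|<\varepsilon_0$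 there is an oval $\Gamma_\varepsilon\in\mathcal N$ with support function $$g_\varepsilon(\varphi)=g(\varphi)+\varepsilon(\varphi-\varphi_0)^4\rho(\varphi-\varphi_0)\qquad(|\varphi-\varphi_0|\le\pi/n)$$ (extended with period $2\pi/n$) such that $|g_\varepsilon^{(j)}-g^{(j)}|\le\delta$ on $\mathbb R$ for all $0\le j\le k$, and such that $(\varphi_0,\alpha_m)$ is a non-resonant elliptic fixed point of the map $T_m$ of $\Gamma_\varepsilon$ with nonzero twist coefficient. -/

import Mathlib

open scoped ContDiff

noncomputable section

/-- The set `𝒩` of `C^∞` ovals with `n`-fold rotational symmetry about the origin of the plane `ℂ`.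
An oval is a closed regular curve with positive curvature, traversed once, and is
parametrized by the angle `φ` of its oriented tangent line: the velocity at `φ` is a positive multiple
(the radius of curvature) of `e^{iφ}`. The symmetry is the rotation by `2π / n`. -/
structure SymmetricOval (n : ℕ) where
  curve : ℝ → ℂ
  smooth : ContDiff ℝ ∞ curve
  closed : ∀ φ : ℝ, curve (φ + 2 * Real.pi) = curve φ
  tangent : ∀ φ : ℝ, ∃ R : ℝ, 0 < R ∧ deriv curve φ = (R : ℂ) * Complex.exp (φ * Complex.I)
  symmetric : ∀ φ : ℝ, curve (φ + 2 * Real.pi / n) =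
    Complex.exp (((2 * Real.pi / n : ℝ) : ℂ) * Complex.I) * curve φ

namespace SymmetricOval

variable {n : ℕ}

/-- The support function `g`: the inner product of the point `Γ(φ)` with the outward unit normal
`-i e^{iφ}` at this point. -/
def support (Γ : SymmetricOval n) (φ : ℝ) : ℝ :=
  inner ℝ (-Complex.I * Complex.exp (φ * Complex.I)) (Γ.curve φ)

/-- The arclength parameter `s(φ)`, with `ds = R dφ`. -/
def arclength (Γ : SymmetricOval n) (φ : ℝ) : ℝ :=
  ∫ t in (0 : ℝ)..φ, ‖deriv Γ.curve t‖

/-- The canonical variables `(s, p) = (s(φ), cos α)` of the point `(φ, α)` of the phase space. -/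
def canonical (Γ : SymmetricOval n) (x : ℝ × ℝ) : ℝ × ℝ :=
  (Γ.arclength x.1, Real.cos x.2)

/-- The ray that leaves `Γ(φ)` at the angle `α` with the oriented tangent line, that is, in the direction
`e^{i(φ+α)}`, hits the oval again at `Γ(φ')`. For `0 < α < π` there is exactly one
such `φ'` between `φ` and `φ + 2π`. -/
def IsNextBounce (Γ : SymmetricOval n) (φ α φ' : ℝ) : Prop :=
  φ < φ' ∧ φ' < φ + 2 * Real.pi ∧
    ∃ L : ℝ, 0 < L ∧
      Γ.curve φ' - Γ.curve φ = (L : ℂ) * Complex.exp (((φ + α : ℝ) : ℂ) * Complex.I)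

/-- The tangent angle of the next bounce (meaningful for `0 < α < π`). -/
def nextBounce (Γ : SymmetricOval n) (φ α : ℝ) : ℝ :=
  Classical.epsilon (Γ.IsNextBounce φ α)

/-- The billiard map `(φ, α) ↦ (φ₁, α₁)`, with the tangent angle lifted to `ℝ`. The particle
arrives at `Γ(φ₁)` in the direction `φ + α`, is reflected into the direction `2 φ₁ - (φ + α)`,
and therefore leaves at the angle `α₁ = φ₁ - (φ + α)` with the tangent line. -/
def billiardMap (Γ : SymmetricOval n) (x : ℝ × ℝ) : ℝ × ℝ :=
  (Γ.nextBounce x.1 x.2, Γ.nextBounce x.1 x.2 - (x.1 + x.2))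

/-- The map `T_m`: the lift, `(φ, α) ↦ T(φ, α) - (2πm/n, 0)`, of the map that the billiard map
induces on the quotient of the phase space by the rotation by `2π/n`. -/
def quotientMap (Γ : SymmetricOval n) (m : ℕ) (x : ℝ × ℝ) : ℝ × ℝ :=
  Γ.billiardMap x - (2 * Real.pi * m / n, 0)

end SymmetricOval

/-- `μ` is a complex eigenvalue of the derivative of the planar map `F` at `x`. -/
def IsMultiplier (F : ℝ × ℝ → ℝ × ℝ) (x : ℝ × ℝ) (μ : ℂ) : Prop :=
  ((fderiv ℝ F x : ℝ × ℝ →ₗ[ℝ] ℝ × ℝ).charpoly.map (algebraMap ℝ ℂ)).IsRoot μ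

/-- `x` is an elliptic fixed point of `F`: the eigenvalues of the derivative are non-real and
of modulus one. -/
def IsEllipticFixedPoint (F : ℝ × ℝ → ℝ × ℝ) (x : ℝ × ℝ) : Prop :=
  DifferentiableAt ℝ F x ∧ F x = x ∧ ∀ μ : ℂ, IsMultiplier F x μ → ‖μ‖ = 1 ∧ μ.im ≠ 0

/-- Non-resonance up to order four. -/
def IsNonResonant (F : ℝ × ℝ → ℝ × ℝ) (x : ℝ × ℝ) : Prop :=
  ∀ μ : ℂ, IsMultiplier F x μ → ∀ j ∈ Finset.Icc 1 4, μ ^ j ≠ 1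

namespace SymmetricOval

variable {n : ℕ}

/-- `τ` is the first Birkhoff coefficient (twist coefficient) of the map `F` of the phase space at its
fixed point `x`: there is a `C^∞` change `z = Ψ(s, p)` of the canonical variables near `x`, sending `x` to `0`, in which
`F` becomes `z ↦ e^{i(ζ + τ|z|²)} z + O(|z|⁴)`. The Jacobian determinant of `Ψ` at the point is
required to be one: so `Ψ` is a local diffeomorphism, and the scale and the sign of `τ` are fixed. -/
def HasTwistCoefficient (Γ : SymmetricOval n) (F : ℝ × ℝ → ℝ × ℝ) (x : ℝ × ℝ) (τ : ℝ) : Prop :=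
  ∃ (U : Set (ℝ × ℝ)) (Ψ : ℝ × ℝ → ℂ) (ζ : ℝ),
    IsOpen U ∧ Γ.canonical x ∈ U ∧ ContDiffOn ℝ ∞ Ψ U ∧ Ψ (Γ.canonical x) = 0 ∧
    (fderiv ℝ Ψ (Γ.canonical x) (1, 0)).re * (fderiv ℝ Ψ (Γ.canonical x) (0, 1)).im -
      (fderiv ℝ Ψ (Γ.canonical x) (1, 0)).im * (fderiv ℝ Ψ (Γ.canonical x) (0, 1)).re = 1 ∧
    (fun y => Ψ (Γ.canonical (F y)) -
        Complex.exp (((ζ + τ * ‖Ψ (Γ.canonical y)‖ ^ 2 : ℝ) : ℂ) * Complex.I) *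
          Ψ (Γ.canonical y))
      =O[nhds x] fun y => ‖Ψ (Γ.canonical y)‖ ^ 4

/-- The `C^k` distance of two ovals, measured on their support functions, is at most `δ`. -/
def CkClose (k : ℕ) (δ : ℝ) (Γ Γ' : SymmetricOval n) : Prop :=
  ∀ j ≤ k, ∀ φ : ℝ, |iteratedDeriv j Γ.support φ - iteratedDeriv j Γ'.support φ| ≤ δ

end SymmetricOval

/-- A smooth even cut-off function, equal to one on `(-δ₁, δ₁)`, zero outside `[-δ₂, δ₂]`, and
decreasing with bounded slope in between. -/
structure IsCutoff (δ₁ δ₂ : ℝ) (ρ : ℝ → ℝ) : Prop where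
  pos : 0 < δ₁
  lt : δ₁ < δ₂
  smooth : ContDiff ℝ ∞ ρ
  even : ∀ t : ℝ, ρ (-t) = ρ t
  eq_zero : ∀ t : ℝ, δ₂ < |t| → ρ t = 0
  eq_one : ∀ t : ℝ, |t| < δ₁ → ρ t = 1
  slope : ∃ C : ℝ, ∀ t : ℝ, δ₁ < t → t < δ₂ → 0 < -deriv ρ t ∧ -deriv ρ t < C

end

open scoped ComplexConjugate
open Set Filter Topology Asymptotics

noncomputable section

/-! A quartic change of the support function moves the curve only to third order, so it leaves the
linear part at the fixed point alone and acts on the cubic terms, which determine the twist.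

If `h` is `ε(φ - φ₀)⁴` near `φ₀`, the curve moves by `(h' - ih)e^{iφ}`, whose leading term is
tangential and cubic. Writing `R`, `g` for the radius and support at `φ₀`, and `x`, `x'` for the
distances of a bounce and the next one from their positions on the fixed orbit, the next bounce
shifts by `-(4ε/R)(x³ + x'³)` up to fourth order (`nextBounce_sub_nextBounce_isBigO`). Hence the
multipliers are unchanged, and ellipticity and non-resonance persist.

Zero twist of the old map supplies a complex coordinate `w` in which it is `w ↦ λw + O(|w|⁴)`. There
the new map is `λw + k(x³ + x'³) + O(|w|⁴)`, with `x = 2 Re(aw)` and `x' = 2 Re(aλw)` up to second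
order. Non-resonance lets a cubic change of variables remove every cubic monomial except `w²w̄`
(`exists_birkhoff_normalForm`), whose coefficient is `3ka²ā(1 + λ)`. With `q = 2g/R` and `λ = q - 1
+ iσ` (`exists_rotation_angle`), this equals `iλτ` for `τ = 12εq|a|²/(Rσ)`, and no factor vanishes.
Since `h + h''` vanishes at `φ₀`, the radius there is unchanged, so passing to the canonical
variables of the new oval preserves the Jacobian normalization (`hasTwistCoefficient_of_perturb`).

The same linear algebra gives `q ≠ 2`, that is `g''(φ₀) = R - g ≠ 0`, so `g'` has no zeros in a
punctured neighbourhood of `φ₀`. Compactness and periodicity bound `h` and its derivatives, so small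
`ε` keeps the curvature positive and the ovals close. -/

namespace SymmetricOval

/-! ### Radius of curvature and arclength -/

variable {n : ℕ} (Γ : SymmetricOval n)

/-- The radius of curvature. -/
def radius (φ : ℝ) : ℝ := ‖deriv Γ.curve φ‖

lemma radius_pos_and_deriv_curve (φ : ℝ) :
    0 < Γ.radius φ ∧ deriv Γ.curve φ = (Γ.radius φ : ℂ) * Complex.exp (φ * Complex.I) := by
  obtain ⟨R, hR, h⟩ := Γ.tangent φ
  have : Γ.radius φ = R := by
    rw [radius, h, norm_mul, Complex.norm_exp_ofReal_mul_I, mul_one, Complex.norm_real,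
      Real.norm_of_nonneg hR.le]
  exact ⟨this ▸ hR, by rw [this, h]⟩

lemma radius_pos (φ : ℝ) : 0 < Γ.radius φ := (Γ.radius_pos_and_deriv_curve φ).1

lemma hasDerivAt_curve (φ : ℝ) :
    HasDerivAt Γ.curve ((Γ.radius φ : ℂ) * Complex.exp (φ * Complex.I)) φ := by
  rw [← (Γ.radius_pos_and_deriv_curve φ).2]
  exact (Γ.smooth.differentiable (by simp) φ).hasDerivAt

lemma contDiff_exp_mul_I : ContDiff ℝ ∞ fun φ : ℝ => Complex.exp (φ * Complex.I) :=
  (Complex.ofRealCLM.contDiff.mul contDiff_const).cexp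

lemma exp_mul_I_mul_exp_mul_I (a b : ℝ) : Complex.exp (a * Complex.I) * Complex.exp (b * Complex.I) =
    Complex.exp (((a + b : ℝ) : ℂ) * Complex.I) := by
  rw [← Complex.exp_add, ← add_mul, Complex.ofReal_add]

lemma hasDerivAt_exp_mul_I (φ : ℝ) : HasDerivAt (fun φ : ℝ => Complex.exp (φ * Complex.I))
    (Complex.exp (φ * Complex.I) * Complex.I) φ := by
  have := ((Complex.ofRealCLM.hasDerivAt (x := φ)).mul_const Complex.I).cexp
  simpa using this

/-- Rotating the velocity by `-φ` makes it real and equal to the radius, so smoothness follows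
without differentiating a norm. -/
lemma contDiff_radius : ContDiff ℝ ∞ Γ.radius := by
  have h : Γ.radius = fun φ => (deriv Γ.curve φ * Complex.exp ((-φ : ℝ) * Complex.I)).re := by
    funext φ
    rw [(Γ.radius_pos_and_deriv_curve φ).2, mul_assoc, ← Complex.exp_add]
    simp
  rw [h]
  have h1 : ContDiff ℝ ∞ (deriv Γ.curve) := (contDiff_infty_iff_deriv.1 Γ.smooth).2
  exact Complex.reCLM.contDiff.comp (h1.mul (contDiff_exp_mul_I.comp contDiff_neg))

lemma continuous_radius : Continuous Γ.radius := Γ.contDiff_radius.continuous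

lemma periodic_radius : Function.Periodic Γ.radius (2 * Real.pi) := fun φ => by
  have : (fun t => Γ.curve (t + 2 * Real.pi)) = Γ.curve := funext Γ.closed
  rw [radius, radius, ← deriv_comp_add_const, this]

lemma exists_pos_le_radius : ∃ c > 0, ∀ φ, c ≤ Γ.radius φ := by
  obtain ⟨x, ⟨y, rfl⟩, hx⟩ := (Γ.periodic_radius.compact_of_continuous
    (by positivity) Γ.continuous_radius).exists_isLeast (range_nonempty _)
  exact ⟨_, Γ.radius_pos y, fun φ => hx (mem_range_self φ)⟩

lemma hasDerivAt_arclength (φ : ℝ) : HasDerivAt Γ.arclength (Γ.radius φ) φ :=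
  intervalIntegral.integral_hasDerivAt_right (Γ.continuous_radius.intervalIntegrable _ _)
    (Γ.continuous_radius.stronglyMeasurableAtFilter _ _) Γ.continuous_radius.continuousAt

lemma contDiff_arclength : ContDiff ℝ ∞ Γ.arclength := by
  rw [contDiff_infty_iff_deriv]
  refine ⟨fun φ => (Γ.hasDerivAt_arclength φ).differentiableAt, ?_⟩
  rw [funext fun φ => (Γ.hasDerivAt_arclength φ).deriv]
  exact Γ.contDiff_radius

lemma strictMono_arclength : StrictMono Γ.arclength :=
  strictMono_of_deriv_pos fun φ => by
    rw [(Γ.hasDerivAt_arclength φ).deriv]; exact Γ.radius_pos φ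

lemma surjective_arclength : Function.Surjective Γ.arclength := by
  obtain ⟨c, hc, h⟩ := Γ.exists_pos_le_radius
  have hm : Monotone fun φ => Γ.arclength φ - c * φ := by
    have hd : ∀ φ, HasDerivAt (fun φ => Γ.arclength φ - c * φ) (Γ.radius φ - c) φ := fun φ => by
      have := (Γ.hasDerivAt_arclength φ).sub ((hasDerivAt_id φ).const_mul c)
      rwa [mul_one] at this
    refine monotone_of_deriv_nonneg (fun φ => (hd φ).differentiableAt) fun φ => ?_
    rw [(hd φ).deriv]; linarith [h φ]
  have h0 : Γ.arclength 0 = 0 := by simp [arclength]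
  refine Γ.contDiff_arclength.continuous.surjective ?_ ?_
  · refine tendsto_atTop_mono' _ ?_ (tendsto_id.const_mul_atTop hc)
    filter_upwards [eventually_ge_atTop 0] with x hx
    have := hm hx
    simp only [h0] at this
    simp only [id]; linarith
  · refine tendsto_atBot_mono' _ ?_ (tendsto_id.const_mul_atBot hc)
    filter_upwards [eventually_le_atBot 0] with x hx
    have := hm hx
    simp only [h0] at this
    simp only [id]; linarith

/-- The arclength as a homeomorphism of the line. -/
def arclengthHomeomorph : ℝ ≃ₜ ℝ :=
  (Γ.strictMono_arclength.orderIsoOfSurjective _ Γ.surjective_arclength).toHomeomorph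

lemma contDiff_arclengthHomeomorph_symm : ContDiff ℝ ∞ Γ.arclengthHomeomorph.symm :=
  Γ.arclengthHomeomorph.contDiff_symm_deriv (fun φ => (Γ.radius_pos φ).ne')
    Γ.hasDerivAt_arclength Γ.contDiff_arclength

lemma hasDerivAt_arclengthHomeomorph_symm (φ : ℝ) :
    HasDerivAt Γ.arclengthHomeomorph.symm (Γ.radius φ)⁻¹ (Γ.arclength φ) := by
  have h := Γ.arclengthHomeomorph.toOpenPartialHomeomorph.hasDerivAt_symm
    (a := Γ.arclength φ) (f' := Γ.radius φ) (mem_univ _) (Γ.radius_pos φ).ne' ?_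
  · exact h
  · have : Γ.arclengthHomeomorph.symm (Γ.arclength φ) = φ := Γ.arclengthHomeomorph.symm_apply_apply φ
    rw [Homeomorph.toOpenPartialHomeomorph_symm_apply, this]
    exact Γ.hasDerivAt_arclength φ

/-! ### Existence and uniqueness of the next bounce -/

/-- The signed distance of `Γ(t)` from the ray that leaves `Γ(φ)` at the angle `α`. -/
def rayOffset (φ α t : ℝ) : ℝ :=
  ((Γ.curve t - Γ.curve φ) * Complex.exp ((-(φ + α) : ℝ) * Complex.I)).im

/-- The sign of the sine splits a full turn into arcs on which the offset is monotone; the whole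
analysis of bounces rests on this. -/
lemma hasDerivAt_rayOffset (φ α t : ℝ) :
    HasDerivAt (Γ.rayOffset φ α) (Γ.radius t * Real.sin (t - (φ + α))) t := by
  have h := (((Γ.hasDerivAt_curve t).sub_const (Γ.curve φ)).mul_const
    (Complex.exp ((-(φ + α) : ℝ) * Complex.I)))
  have h2 := Complex.imCLM.hasFDerivAt.comp_hasDerivAt t h
  rwa [Complex.imCLM_apply, mul_assoc, exp_mul_I_mul_exp_mul_I, Complex.im_ofReal_mul,
    Complex.exp_ofReal_mul_I_im, ← sub_eq_add_neg] at h2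

lemma rayOffset_self (φ α : ℝ) : Γ.rayOffset φ α φ = 0 := by simp [rayOffset]

lemma rayOffset_add_two_pi (φ α : ℝ) : Γ.rayOffset φ α (φ + 2 * Real.pi) = 0 := by
  simp [rayOffset, Γ.closed]

lemma continuous_rayOffset (φ α : ℝ) : Continuous (Γ.rayOffset φ α) :=
  continuous_iff_continuousAt.2 fun t => (Γ.hasDerivAt_rayOffset φ α t).continuousAt

lemma strictMonoOn_rayOffset (φ α : ℝ) :
    StrictMonoOn (Γ.rayOffset φ α) (Icc (φ + α) (φ + α + Real.pi)) := by
  refine strictMonoOn_of_deriv_pos (convex_Icc _ _) (Γ.continuous_rayOffset φ α).continuousOn ?_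
  intro t ht
  rw [interior_Icc] at ht
  rw [(Γ.hasDerivAt_rayOffset φ α t).deriv]
  exact mul_pos (Γ.radius_pos t) (Real.sin_pos_of_pos_of_lt_pi (by linarith [ht.1])
    (by linarith [ht.2]))

lemma strictAntiOn_rayOffset (φ α : ℝ) :
    StrictAntiOn (Γ.rayOffset φ α) (Icc (φ + α - Real.pi) (φ + α)) := by
  refine strictAntiOn_of_deriv_neg (convex_Icc _ _) (Γ.continuous_rayOffset φ α).continuousOn ?_
  intro t ht
  rw [interior_Icc] at ht
  rw [(Γ.hasDerivAt_rayOffset φ α t).deriv]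
  exact mul_neg_of_pos_of_neg (Γ.radius_pos t) (Real.sin_neg_of_neg_of_neg_pi_lt
    (by linarith [ht.2]) (by linarith [ht.1]))

lemma strictAntiOn_rayOffset' (φ α : ℝ) :
    StrictAntiOn (Γ.rayOffset φ α) (Icc (φ + α + Real.pi) (φ + α + 2 * Real.pi)) := by
  refine strictAntiOn_of_deriv_neg (convex_Icc _ _) (Γ.continuous_rayOffset φ α).continuousOn ?_
  intro t ht
  rw [interior_Icc] at ht
  rw [(Γ.hasDerivAt_rayOffset φ α t).deriv, ← Real.sin_sub_two_pi]
  exact mul_neg_of_pos_of_neg (Γ.radius_pos t) (Real.sin_neg_of_neg_of_neg_pi_lt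
    (by linarith [ht.2]) (by linarith [ht.1]))

/-- Convexity: with `α = 0` the ray is tangent, and the offset rises from zero for half a turn and
then falls back to zero. -/
lemma rayOffset_zero_pos {φ t : ℝ} (h1 : φ < t) (h2 : t < φ + 2 * Real.pi) :
    0 < Γ.rayOffset φ 0 t := by
  have hpi := Real.pi_pos
  rcases le_total t (φ + Real.pi) with h | h
  · have := Γ.strictMonoOn_rayOffset φ 0 (a := φ) (b := t) (by constructor <;> linarith)
      (by constructor <;> linarith) h1
    rwa [rayOffset_self] at this
  · have := Γ.strictAntiOn_rayOffset' φ 0 (a := t) (b := φ + 2 * Real.pi)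
      (by constructor <;> linarith) (by constructor <;> linarith) h2
    rwa [rayOffset_add_two_pi] at this

/-- The sign of the chord length is automatic: the oval lies on the inner side of its tangent, and
so does the direction `φ + α`. Bounces thus become zeros of a smooth function. -/
lemma isNextBounce_iff {φ α t : ℝ} (h0 : 0 < α) (hpi : α < Real.pi) :
    Γ.IsNextBounce φ α t ↔ φ < t ∧ t < φ + 2 * Real.pi ∧ Γ.rayOffset φ α t = 0 := by
  refine and_congr_right fun h1 => and_congr_right fun h2 => ⟨?_, fun h => ?_⟩
  · rintro ⟨L, -, hL⟩
    rw [rayOffset, hL, mul_assoc, exp_mul_I_mul_exp_mul_I, add_neg_cancel]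
    simp
  · set z := (Γ.curve t - Γ.curve φ) * Complex.exp ((-(φ + α) : ℝ) * Complex.I) with hz
    have hzr : z = (z.re : ℂ) := Complex.ext rfl h
    have hchord : Γ.curve t - Γ.curve φ = z.re * Complex.exp (((φ + α : ℝ) : ℂ) * Complex.I) := by
      rw [← hzr, hz, mul_assoc, exp_mul_I_mul_exp_mul_I, neg_add_cancel]
      simp
    refine ⟨z.re, ?_, hchord⟩
    -- The offset from the tangent line equals `z.re * sin α`, which forces `z.re > 0`.
    have hpos := Γ.rayOffset_zero_pos h1 h2
    rw [rayOffset, hchord, mul_assoc, exp_mul_I_mul_exp_mul_I,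
      Complex.im_ofReal_mul, Complex.exp_ofReal_mul_I_im] at hpos
    have hs : φ + α + -(φ + 0) = α := by ring
    rw [hs] at hpos
    exact pos_of_mul_pos_left hpos (Real.sin_pos_of_pos_of_lt_pi h0 hpi).le

/-- Any zero of the offset beyond the starting point lies on the far arc. -/
lemma mem_Ioo_of_rayOffset_eq_zero {φ α t : ℝ} (h0 : 0 < α) (hpi : α < Real.pi)
    (h1 : φ < t) (h2 : t < φ + 2 * Real.pi) (h : Γ.rayOffset φ α t = 0) :
    t ∈ Ioo (φ + α) (φ + α + Real.pi) := by
  constructor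
  · by_contra! hle
    have := Γ.strictAntiOn_rayOffset φ α (a := φ) (b := t) (by constructor <;> linarith)
      (by constructor <;> linarith) h1
    rw [rayOffset_self, h] at this
    exact this.false
  · by_contra! hle
    have := Γ.strictAntiOn_rayOffset' φ α (a := t) (b := φ + 2 * Real.pi)
      (by constructor <;> linarith) (by constructor <;> linarith) h2
    rw [rayOffset_add_two_pi, h] at this
    exact this.false

lemma exists_isNextBounce (φ : ℝ) {α : ℝ} (h0 : 0 < α) (hpi : α < Real.pi) :
    ∃ t, Γ.IsNextBounce φ α t := by
  have h1 : Γ.rayOffset φ α (φ + α) < 0 := by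
    have := Γ.strictAntiOn_rayOffset φ α (a := φ) (b := φ + α) (by constructor <;> linarith)
      (by constructor <;> linarith) (by linarith)
    rwa [rayOffset_self] at this
  have h2 : 0 < Γ.rayOffset φ α (φ + α + Real.pi) := by
    have := Γ.strictAntiOn_rayOffset' φ α (a := φ + α + Real.pi) (b := φ + 2 * Real.pi)
      (by constructor <;> linarith) (by constructor <;> linarith) (by linarith)
    rwa [rayOffset_add_two_pi] at this
  obtain ⟨t, ht, h⟩ := intermediate_value_Icc (by linarith) (Γ.continuous_rayOffset φ α).continuousOn
    (show (0 : ℝ) ∈ Icc (Γ.rayOffset φ α (φ + α)) (Γ.rayOffset φ α (φ + α + Real.pi)) from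
      ⟨h1.le, h2.le⟩)
  have ht2 : t ≠ φ + α + Real.pi := by rintro rfl; exact h2.ne' h
  have := lt_of_le_of_ne ht.2 ht2
  exact ⟨t, (Γ.isNextBounce_iff h0 hpi).2 ⟨by linarith [ht.1], by linarith, h⟩⟩

lemma isNextBounce_unique {φ α t t' : ℝ} (h0 : 0 < α) (hpi : α < Real.pi)
    (h : Γ.IsNextBounce φ α t) (h' : Γ.IsNextBounce φ α t') : t = t' := by
  rw [Γ.isNextBounce_iff h0 hpi] at h h'
  have m := Γ.mem_Ioo_of_rayOffset_eq_zero h0 hpi h.1 h.2.1 h.2.2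
  have m' := Γ.mem_Ioo_of_rayOffset_eq_zero h0 hpi h'.1 h'.2.1 h'.2.2
  exact (Γ.strictMonoOn_rayOffset φ α).injOn (Ioo_subset_Icc_self m) (Ioo_subset_Icc_self m')
    (h.2.2.trans h'.2.2.symm)

lemma isNextBounce_nextBounce (φ : ℝ) {α : ℝ} (h0 : 0 < α) (hpi : α < Real.pi) :
    Γ.IsNextBounce φ α (Γ.nextBounce φ α) :=
  Classical.epsilon_spec (Γ.exists_isNextBounce φ h0 hpi)

lemma nextBounce_eq {φ α t : ℝ} (h0 : 0 < α) (hpi : α < Real.pi) (h : Γ.IsNextBounce φ α t) :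
    Γ.nextBounce φ α = t :=
  Γ.isNextBounce_unique h0 hpi (Γ.isNextBounce_nextBounce φ h0 hpi) h

lemma rayOffset_nextBounce (φ : ℝ) {α : ℝ} (h0 : 0 < α) (hpi : α < Real.pi) :
    Γ.rayOffset φ α (Γ.nextBounce φ α) = 0 :=
  ((Γ.isNextBounce_iff h0 hpi).1 (Γ.isNextBounce_nextBounce φ h0 hpi)).2.2

end SymmetricOval

/-! ### Cut-off functions and periodization -/

lemma hasDerivAt_expNegInvGlue (x : ℝ) :
    HasDerivAt expNegInvGlue (x⁻¹ ^ 2 * expNegInvGlue x) x := by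
  simpa using expNegInvGlue.hasDerivAt_polynomial_eval_inv_mul 1 x

lemma Real.smoothTransition.deriv_pos {x : ℝ} (h0 : 0 < x) (h1 : x < 1) :
    0 < deriv Real.smoothTransition x := by
  have hd := hasDerivAt_expNegInvGlue x
  have hd1 : HasDerivAt (fun x => expNegInvGlue (1 - x)) _ x :=
    (hasDerivAt_expNegInvGlue (1 - x)).comp_const_sub 1 x
  have hp := expNegInvGlue.pos_of_pos h0
  have hp1 := expNegInvGlue.pos_of_pos (sub_pos.2 h1)
  have h : HasDerivAt Real.smoothTransition _ x :=
    hd.div (hd.add hd1) (Real.smoothTransition.pos_denom x).ne'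
  rw [h.deriv]
  refine div_pos ?_ (pow_pos (Real.smoothTransition.pos_denom x) 2)
  have e1 : 0 < x⁻¹ ^ 2 := by positivity
  have e2 : 0 < (1 - x)⁻¹ ^ 2 := pow_pos (inv_pos.2 (sub_pos.2 h1)) 2
  have e3 := mul_pos hp hp1
  have e4 := mul_pos e1 e3
  have e5 := mul_pos e2 e3
  nlinarith

/-- Composing the smooth step with a quadratic in `x ^ 2` gives evenness and smoothness at `0` at
once; strict decrease comes from the positive derivative of the step on `(0, 1)`. -/
lemma exists_isCutoff {δ₁ δ₂ : ℝ} (h1 : 0 < δ₁) (h2 : δ₁ < δ₂) : ∃ ρ, IsCutoff δ₁ δ₂ ρ := by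
  have hd : 0 < δ₂ ^ 2 - δ₁ ^ 2 := by nlinarith
  set a : ℝ → ℝ := fun x => (δ₂ ^ 2 - x ^ 2) / (δ₂ ^ 2 - δ₁ ^ 2) with ha
  have hac : ContDiff ℝ ∞ a := (contDiff_const.sub (contDiff_id.pow 2)).div_const _
  have hsm : ContDiff ℝ ∞ fun x => Real.smoothTransition (a x) :=
    Real.smoothTransition.contDiff.comp hac
  have hda : ∀ x, HasDerivAt a (-(2 * x) / (δ₂ ^ 2 - δ₁ ^ 2)) x := fun x => by
    have := (((hasDerivAt_id x).pow 2).const_sub (δ₂ ^ 2)).div_const (δ₂ ^ 2 - δ₁ ^ 2)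
    simpa using this
  refine ⟨fun x => Real.smoothTransition (a x), h1, h2, hsm, fun t => by simp [ha], ?_, ?_, ?_⟩
  · intro t ht
    refine Real.smoothTransition.zero_of_nonpos (div_nonpos_of_nonpos_of_nonneg ?_ hd.le)
    have := sq_abs t
    nlinarith
  · intro t ht
    refine Real.smoothTransition.one_of_one_le ((one_le_div hd).2 ?_)
    have := sq_abs t
    nlinarith [abs_nonneg t]
  · obtain ⟨C, hC⟩ := (isCompact_Icc (a := δ₁) (b := δ₂)).exists_bound_of_continuousOn
      (contDiff_infty_iff_deriv.1 hsm).2.continuous.continuousOn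
    refine ⟨C + 1, fun t ht1 ht2 => ⟨?_, ?_⟩⟩
    · have hs : HasDerivAt Real.smoothTransition (deriv Real.smoothTransition (a t)) (a t) :=
        ((Real.smoothTransition.contDiff (n := 1)).differentiable (by simp) _).hasDerivAt
      have : HasDerivAt (fun x => Real.smoothTransition (a x)) _ t := hs.comp t (hda t)
      rw [this.deriv, neg_pos]
      refine mul_neg_of_pos_of_neg (Real.smoothTransition.deriv_pos ?_ ?_) ?_
      · exact div_pos (by nlinarith) hd
      · rw [div_lt_one hd]; nlinarith
      · exact div_neg_of_neg_of_pos (by linarith) hd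
    · have := hC t ⟨ht1.le, ht2.le⟩
      rw [Real.norm_eq_abs] at this
      linarith [neg_le_abs (deriv (fun x => Real.smoothTransition (a x)) t)]

/-- The extension with period `P` of the restriction of `f` to an interval of length `P` about `0`. -/
def periodize (P : ℝ) (f : ℝ → ℝ) (x : ℝ) : ℝ := f (x - round (x / P) * P)

lemma periodic_periodize {P : ℝ} (hP : 0 < P) (f : ℝ → ℝ) : Function.Periodic (periodize P f) P := by
  intro x
  rw [periodize, periodize, add_div, div_self hP.ne', round_add_one]
  congr 1
  push_cast
  ring

lemma abs_sub_round_div_mul_le {P : ℝ} (hP : 0 < P) (x : ℝ) : |x - round (x / P) * P| ≤ P / 2 := by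
  have h := abs_sub_round (x / P)
  have e : x - round (x / P) * P = (x / P - round (x / P)) * P := by field_simp
  rw [e, abs_mul, abs_of_pos hP]
  nlinarith

/-- If the nearest multiple of `P` is not `k * P`, both arguments lie outside the support of `f`.
The window is open and wider than one period when `δ < P / 2`, so it covers the jumps of `round`. -/
lemma periodize_eq {P δ : ℝ} {f : ℝ → ℝ} (hP : 0 < P) (hf : ∀ x, δ < |x| → f x = 0)
    {x : ℝ} {k : ℤ} (hx : |x - k * P| < P - δ) : periodize P f x = f (x - k * P) := by
  by_cases hk : round (x / P) = k
  · rw [periodize, hk]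
  · have hr := abs_sub_round_div_mul_le hP x
    set r := round (x / P) with hrdef
    have h1 : P ≤ |(r - k : ℝ) * P| := by
      rw [abs_mul, abs_of_pos hP]
      have : (1 : ℝ) ≤ |(r - k : ℝ)| := by
        exact_mod_cast Int.one_le_abs (sub_ne_zero.2 hk)
      nlinarith
    have h2 : (r - k : ℝ) * P = (x - k * P) - (x - r * P) := by ring
    have h3 := abs_sub (x - k * P) (x - r * P)
    rw [h2] at h1
    rw [periodize, ← hrdef, hf _ (by linarith), hf _ (by linarith)]

lemma contDiff_periodize {P δ : ℝ} {f : ℝ → ℝ} (hP : 0 < P) (hδ : δ < P / 2)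
    (hf : ∀ x, δ < |x| → f x = 0) (hs : ContDiff ℝ ∞ f) : ContDiff ℝ ∞ (periodize P f) := by
  refine contDiff_iff_contDiffAt.2 fun x => ?_
  have hx : |x - round (x / P) * P| < P - δ := by
    linarith [abs_sub_round_div_mul_le hP x]
  have hc : ContDiff ℝ ∞ fun y => f (y - round (x / P) * P) := hs.comp (contDiff_id.sub contDiff_const)
  refine hc.contDiffAt.congr_of_eventuallyEq ?_
  have hcont : ContinuousAt (fun y : ℝ => |y - round (x / P) * P|) x := by fun_prop
  filter_upwards [hcont.eventually (gt_mem_nhds hx)] with y hy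
  exact periodize_eq hP hf hy

lemma Function.Periodic.exists_abs_le {f : ℝ → ℝ} {P : ℝ} (hf : Function.Periodic f P) (hP : P ≠ 0)
    (hc : Continuous f) : ∃ C, 0 < C ∧ ∀ x, |f x| ≤ C := by
  obtain ⟨C, hC⟩ := (hf.isBounded_of_continuous hP hc).exists_norm_le
  exact ⟨|C| + 1, by positivity, fun x => by
    have := hC _ (mem_range_self x)
    rw [Real.norm_eq_abs] at this
    linarith [le_abs_self C]⟩

lemma Function.Periodic.iteratedDeriv {f : ℝ → ℝ} {P : ℝ} (hf : Function.Periodic f P) (j : ℕ) :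
    Function.Periodic (iteratedDeriv j f) P := fun x => by
  have h : (fun z => f (z + P)) = f := funext hf
  have := congrFun (iteratedDeriv_comp_add_const j f P) x
  rw [h] at this
  exact this.symm

/-! ### Perturbation of the support function -/

namespace SymmetricOval

variable {n : ℕ} (Γ : SymmetricOval n)

/-- The displacement of the curve that changes its support function by `h`. -/
def displacement (h : ℝ → ℝ) (φ : ℝ) : ℂ :=
  (((deriv h φ : ℝ) : ℂ) - h φ * Complex.I) * Complex.exp (φ * Complex.I)

/-- The `h'` terms cancel, so the velocity stays parallel to `e^{iφ}`: the tangent angle remains the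
parameter and the radius changes by `h + h''`. -/
lemma hasDerivAt_displacement {h : ℝ → ℝ} (hh : ContDiff ℝ ∞ h) (φ : ℝ) :
    HasDerivAt (displacement h)
      (((h φ + deriv (deriv h) φ : ℝ) : ℂ) * Complex.exp (φ * Complex.I)) φ := by
  have hh' := (contDiff_infty_iff_deriv.1 hh).2
  have h0 := (hh.differentiable (by simp) φ).hasDerivAt.ofReal_comp
  have h1 := (hh'.differentiable (by simp) φ).hasDerivAt.ofReal_comp
  have := (h1.sub (h0.mul_const Complex.I)).mul (hasDerivAt_exp_mul_I φ)
  refine this.congr_deriv ?_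
  simp only [Pi.sub_apply]
  push_cast
  linear_combination (-(h φ : ℂ) * Complex.exp (φ * Complex.I)) * Complex.I_sq

lemma contDiff_displacement {h : ℝ → ℝ} (hh : ContDiff ℝ ∞ h) : ContDiff ℝ ∞ (displacement h) := by
  have hh' := (contDiff_infty_iff_deriv.1 hh).2
  exact ((Complex.ofRealCLM.contDiff.comp hh').sub
    ((Complex.ofRealCLM.contDiff.comp hh).mul contDiff_const)).mul contDiff_exp_mul_I

lemma displacement_add_of_periodic {h : ℝ → ℝ} {P : ℝ} (hp : Function.Periodic h P) (φ : ℝ) :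
    displacement h (φ + P) = Complex.exp ((P : ℂ) * Complex.I) * displacement h φ := by
  have hd : deriv h (φ + P) = deriv h φ := by
    have : (fun t => h (t + P)) = h := funext hp
    rw [← deriv_comp_add_const, this]
  rw [displacement, displacement, hd, hp, ← exp_mul_I_mul_exp_mul_I]
  ring

/-- The oval with the support function `g + h`. -/
def perturb (hn : n ≠ 0) (h : ℝ → ℝ) (hh : ContDiff ℝ ∞ h)
    (hp : Function.Periodic h (2 * Real.pi / n))
    (hpos : ∀ φ, 0 < Γ.radius φ + (h φ + deriv (deriv h) φ)) : SymmetricOval n where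
  curve φ := Γ.curve φ + displacement h φ
  smooth := Γ.smooth.add (contDiff_displacement hh)
  closed φ := by
    have hp2 : Function.Periodic h (2 * Real.pi) := by
      have := hp.nat_mul n
      rwa [mul_div_cancel₀ _ (Nat.cast_ne_zero.2 hn)] at this
    have := displacement_add_of_periodic hp2 φ
    push_cast at this
    rw [Γ.closed, this, Complex.exp_two_pi_mul_I, one_mul]
  tangent φ := by
    refine ⟨_, hpos φ, ?_⟩
    have : HasDerivAt (fun φ => Γ.curve φ + displacement h φ) _ φ :=
      (Γ.hasDerivAt_curve φ).add (hasDerivAt_displacement hh φ)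
    rw [this.deriv, ← add_mul, ← Complex.ofReal_add]
  symmetric φ := by
    rw [Γ.symmetric, displacement_add_of_periodic hp]
    ring

section perturb

variable {hn : n ≠ 0} {h : ℝ → ℝ} {hh : ContDiff ℝ ∞ h}
    {hp : Function.Periodic h (2 * Real.pi / n)}
    {hpos : ∀ φ, 0 < Γ.radius φ + (h φ + deriv (deriv h) φ)}

lemma curve_perturb (φ : ℝ) :
    (Γ.perturb hn h hh hp hpos).curve φ = Γ.curve φ + displacement h φ := rfl

lemma radius_perturb (φ : ℝ) :
    (Γ.perturb hn h hh hp hpos).radius φ = Γ.radius φ + (h φ + deriv (deriv h) φ) := by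
  have : HasDerivAt (Γ.perturb hn h hh hp hpos).curve _ φ :=
      (Γ.hasDerivAt_curve φ).add (hasDerivAt_displacement hh φ)
  rw [radius, this.deriv, ← add_mul, ← Complex.ofReal_add, norm_mul, Complex.norm_exp_ofReal_mul_I,
    mul_one, Complex.norm_real, Real.norm_of_nonneg (hpos φ).le]

lemma support_eq (φ : ℝ) :
    Γ.support φ = -(Γ.curve φ * Complex.exp ((-φ : ℝ) * Complex.I)).im := by
  rw [support, Complex.inner]
  simp only [map_mul, map_neg, ← Complex.exp_conj, Complex.conj_ofReal, Complex.conj_I]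
  have : Γ.curve φ * (-(-Complex.I) * Complex.exp (φ * -Complex.I)) =
    (Γ.curve φ * Complex.exp ((-φ : ℝ) * Complex.I)) * Complex.I := by
    rw [Complex.ofReal_neg, neg_mul_comm (φ : ℂ)]
    ring
  rw [this, Complex.mul_I_re]

lemma support_perturb (φ : ℝ) :
    (Γ.perturb hn h hh hp hpos).support φ = Γ.support φ + h φ := by
  rw [support_eq, support_eq, curve_perturb, add_mul, Complex.add_im, displacement, mul_assoc,
    exp_mul_I_mul_exp_mul_I, add_neg_cancel]
  rw [Complex.ofReal_zero, zero_mul, Complex.exp_zero, mul_one, Complex.sub_im, Complex.mul_I_im,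
    Complex.ofReal_im, Complex.ofReal_re]
  ring

end perturb

lemma contDiff_support : ContDiff ℝ ∞ Γ.support := by
  rw [funext Γ.support_eq]
  exact (Complex.imCLM.contDiff.comp (Γ.smooth.mul (contDiff_exp_mul_I.comp contDiff_neg))).neg

lemma hasDerivAt_curve_mul_exp (φ : ℝ) :
    HasDerivAt (fun φ => Γ.curve φ * Complex.exp ((-φ : ℝ) * Complex.I))
      (Γ.radius φ - Γ.curve φ * Complex.exp ((-φ : ℝ) * Complex.I) * Complex.I) φ := by
  have h1 : HasDerivAt (fun φ : ℝ => Complex.exp ((-φ : ℝ) * Complex.I))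
      ((-1 : ℝ) • (Complex.exp ((-φ : ℝ) * Complex.I) * Complex.I)) φ :=
    HasDerivAt.scomp φ (hasDerivAt_exp_mul_I (-φ)) (hasDerivAt_neg φ)
  refine ((Γ.hasDerivAt_curve φ).mul h1).congr_deriv ?_
  rw [mul_assoc, exp_mul_I_mul_exp_mul_I, add_neg_cancel]
  simp only [Complex.ofReal_zero, zero_mul, Complex.exp_zero, neg_smul, one_smul]
  ring

lemma deriv_support (φ : ℝ) :
    deriv Γ.support φ = (Γ.curve φ * Complex.exp ((-φ : ℝ) * Complex.I)).re := by
  have h := (Complex.imCLM.hasFDerivAt.comp_hasDerivAt φ (Γ.hasDerivAt_curve_mul_exp φ)).neg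
  rw [funext Γ.support_eq]
  refine h.deriv.trans ?_
  rw [Complex.imCLM_apply, Complex.sub_im, Complex.mul_I_im, Complex.ofReal_im]
  ring

/-- The identity `g'' = R - g` turns non-degeneracy of `g'` at `φ₀` into the linear condition `R ≠
g`. -/
lemma hasDerivAt_deriv_support (φ : ℝ) :
    HasDerivAt (deriv Γ.support) (Γ.radius φ - Γ.support φ) φ := by
  rw [funext Γ.deriv_support]
  refine (Complex.reCLM.hasFDerivAt.comp_hasDerivAt φ
    (Γ.hasDerivAt_curve_mul_exp φ)).congr_deriv ?_
  rw [support_eq, Complex.reCLM_apply, Complex.sub_re, Complex.mul_I_re, Complex.ofReal_re]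

end SymmetricOval

/-! ### Differentiability of the billiard map and its derivative at the fixed point -/

/-- Second-order control of the increments of a `C²` function. -/
lemma ContDiffAt.sub_sub_fderiv_isBigO {ι E F : Type*} [NormedAddCommGroup E] [NormedSpace ℝ E]
    [NormedAddCommGroup F] [NormedSpace ℝ F] {f : E → F} {x : E} (hf : ContDiffAt ℝ 2 f x)
    {l : Filter ι} {a b : ι → E} {N : ι → ℝ} (ha : (fun i => a i - x) =O[l] N)
    (hb : (fun i => b i - x) =O[l] N) (hN : Tendsto N l (𝓝 0)) :
    (fun i => f (a i) - f (b i) - fderiv ℝ f x (a i - b i)) =O[l] fun i => N i * ‖a i - b i‖ := by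
  have hd : DifferentiableAt ℝ (fderiv ℝ f) x :=
    (hf.fderiv_right (m := 1) (by norm_num)).differentiableAt one_ne_zero
  obtain ⟨K, hK0, hK⟩ := hd.isBigO_sub.exists_nonneg
  have hev : ∀ᶠ z in 𝓝 x, DifferentiableAt ℝ f z :=
    (hf.eventually (by simp)).mono fun z hz => hz.differentiableAt (by simp)
  obtain ⟨r, hr, hball⟩ := Metric.eventually_nhds_iff_ball.1 (hev.and hK.bound)
  obtain ⟨A, hA0, hA⟩ := ha.exists_nonneg
  obtain ⟨B, hB0, hB⟩ := hb.exists_nonneg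
  have hsmall : ∀ᶠ i in l, (A + B) * ‖N i‖ < r := by
    have : Tendsto (fun i => (A + B) * ‖N i‖) l (𝓝 0) := by
      simpa using hN.norm.const_mul (A + B)
    exact this.eventually (gt_mem_nhds hr)
  refine IsBigO.of_bound (K * (A + B)) ?_
  filter_upwards [hA.bound, hB.bound, hsmall] with i hAi hBi hi
  have hsub : Metric.closedBall x ((A + B) * ‖N i‖) ⊆ Metric.ball x r :=
    Metric.closedBall_subset_ball hi
  have hN0 := norm_nonneg (N i)
  have key := (convex_closedBall x ((A + B) * ‖N i‖)).norm_image_sub_le_of_norm_hasFDerivWithin_le'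
    (f := f) (f' := fderiv ℝ f) (φ := fderiv ℝ f x) (C := K * ((A + B) * ‖N i‖))
    (fun z hz => (hball z (hsub hz)).1.hasFDerivAt.hasFDerivWithinAt)
    (fun z hz => (hball z (hsub hz)).2.trans
      (mul_le_mul_of_nonneg_left (mem_closedBall_iff_norm.1 hz) hK0))
    (x := b i) (y := a i)
    (mem_closedBall_iff_norm.2 (hBi.trans (by nlinarith)))
    (mem_closedBall_iff_norm.2 (hAi.trans (by nlinarith)))
  refine key.trans (le_of_eq ?_)
  rw [norm_mul, norm_norm]
  ring

namespace SymmetricOval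

variable {n : ℕ} (Γ : SymmetricOval n)

/-- The offset from the ray as a function of all its arguments. -/
def offset (p : (ℝ × ℝ) × ℝ) : ℝ := Γ.rayOffset p.1.1 p.1.2 p.2

lemma contDiff_offset : ContDiff ℝ ∞ Γ.offset := by
  have h1 : ContDiff ℝ ∞ fun p : (ℝ × ℝ) × ℝ => Γ.curve p.2 := Γ.smooth.comp contDiff_snd
  have h2 : ContDiff ℝ ∞ fun p : (ℝ × ℝ) × ℝ => Γ.curve p.1.1 :=
    Γ.smooth.comp (contDiff_fst.comp contDiff_fst)
  have h3 : ContDiff ℝ ∞ fun p : (ℝ × ℝ) × ℝ => -(p.1.1 + p.1.2) := by fun_prop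
  exact Complex.imCLM.contDiff.comp ((h1.sub h2).mul (contDiff_exp_mul_I.comp h3))

lemma fderiv_offset (φ α t x β s : ℝ) :
    fderiv ℝ Γ.offset ((φ, α), t) ((x, β), s) =
      Γ.radius t * Real.sin (t - (φ + α)) * s + Γ.radius φ * Real.sin α * x -
        (x + β) * ((Γ.curve t - Γ.curve φ) * Complex.exp ((-(φ + α) : ℝ) * Complex.I)).re := by
  have hlin : ∀ c d : ℝ, HasDerivAt (fun r : ℝ => c + r * d) d 0 := fun c d => by
    simpa using ((hasDerivAt_id (0 : ℝ)).mul_const d).const_add c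
  have hF := (Γ.contDiff_offset.differentiable (by simp) ((φ, α), t)).hasFDerivAt
  have hl : HasDerivAt (fun r : ℝ => ((φ + r * x, α + r * β), t + r * s)) ((x, β), s) 0 :=
    ((hlin φ x).prodMk (hlin α β)).prodMk (hlin t s)
  have hcomp := HasFDerivAt.comp_hasDerivAt_of_eq (0 : ℝ) hF hl (by simp)
  have h1 : HasDerivAt (fun r : ℝ => Γ.curve (t + r * s)) _ 0 :=
    HasDerivAt.scomp_of_eq (0 : ℝ) (Γ.hasDerivAt_curve t) (hlin t s) (by simp)
  have h2 : HasDerivAt (fun r : ℝ => Γ.curve (φ + r * x)) _ 0 :=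
    HasDerivAt.scomp_of_eq (0 : ℝ) (Γ.hasDerivAt_curve φ) (hlin φ x) (by simp)
  have h3 : HasDerivAt (fun r : ℝ => Complex.exp
      (((-((φ + r * x) + (α + r * β)) : ℝ) : ℂ) * Complex.I)) _ 0 :=
    HasDerivAt.scomp_of_eq (g₁ := fun ψ : ℝ => Complex.exp (ψ * Complex.I)) (0 : ℝ)
      (hasDerivAt_exp_mul_I (-(φ + α)))
      ((hlin φ x).add (hlin α β)).neg (by simp)
  have h4 := Complex.imCLM.hasFDerivAt.comp_hasDerivAt (0 : ℝ) ((h1.sub h2).mul h3)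
  refine (hcomp.unique h4).trans ?_
  simp only [Complex.imCLM_apply, Complex.real_smul, zero_mul, add_zero, Pi.sub_apply]
  have e : ∀ c d : ℝ, ∀ ψ : ℝ, ((c : ℂ) * (d * Complex.exp (ψ * Complex.I)) *
      Complex.exp ((-(φ + α) : ℝ) * Complex.I)).im = c * (d * Real.sin (ψ - (φ + α))) := by
    intro c d ψ
    rw [← mul_assoc, mul_assoc, exp_mul_I_mul_exp_mul_I, ← Complex.ofReal_mul,
      Complex.im_ofReal_mul, Complex.exp_ofReal_mul_I_im, ← sub_eq_add_neg, mul_assoc]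
  rw [Complex.add_im, sub_mul, Complex.sub_im, e, e,
    show φ - (φ + α) = -α by ring, Real.sin_neg, mul_left_comm (Γ.curve t - Γ.curve φ),
    ← mul_assoc (Γ.curve t - Γ.curve φ),
    Complex.im_ofReal_mul, Complex.mul_I_im]
  ring

/-- Implicit function theorem for the offset: the ray hits the far arc transversally. Uniqueness of
bounces identifies the implicit function with `nextBounce`. -/
lemma hasStrictFDerivAt_nextBounce (φ : ℝ) {α : ℝ} (h0 : 0 < α) (hpi : α < Real.pi) :
    ∃ D : ℝ × ℝ →L[ℝ] ℝ, HasStrictFDerivAt (fun y : ℝ × ℝ => Γ.nextBounce y.1 y.2) D (φ, α) := by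
  set t := Γ.nextBounce φ α with ht
  obtain ⟨h1, h2, h3⟩ := (Γ.isNextBounce_iff h0 hpi).1 (Γ.isNextBounce_nextBounce φ h0 hpi)
  rw [← ht] at h1 h2 h3
  have hm := Γ.mem_Ioo_of_rayOffset_eq_zero h0 hpi h1 h2 h3
  have hne : Γ.radius t * Real.sin (t - (φ + α)) ≠ 0 :=
    (mul_pos (Γ.radius_pos t) (Real.sin_pos_of_pos_of_lt_pi (by linarith [hm.1])
      (by linarith [hm.2]))).ne'
  have hc : ContDiffAt ℝ 1 Γ.offset ((φ, α), t) := (Γ.contDiff_offset.of_le (by simp)).contDiffAt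
  have hinv : (fderiv ℝ Γ.offset ((φ, α), t) ∘L .inr ℝ (ℝ × ℝ) ℝ).IsInvertible := by
    refine ⟨ContinuousLinearEquiv.unitsEquivAut ℝ (Units.mk0 _ hne), ?_⟩
    ext
    have := Γ.fderiv_offset φ α t 0 0 1
    simp only [mul_zero, add_zero, zero_mul, sub_zero, mul_one] at this
    rw [Prod.mk_zero_zero] at this
    simpa using this.symm
  have hs := hc.hasStrictFDerivAt_implicitFunction one_ne_zero hinv
  have hself := hc.implicitFunction_apply_self one_ne_zero hinv
  refine ⟨_, hs.congr_of_eventuallyEq ?_⟩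
  have hcont := hs.continuousAt
  simp only at hself hcont
  have e1 : ∀ᶠ y : ℝ × ℝ in 𝓝 (φ, α), y.1 < hc.implicitFunction one_ne_zero hinv y := by
    refine continuousAt_fst.eventually_lt hcont ?_
    rwa [hself]
  have e2 : ∀ᶠ y : ℝ × ℝ in 𝓝 (φ, α),
      hc.implicitFunction one_ne_zero hinv y < y.1 + 2 * Real.pi := by
    refine hcont.eventually_lt (continuousAt_fst.add continuousAt_const) ?_
    rwa [hself]
  have e3 : ∀ᶠ y : ℝ × ℝ in 𝓝 (φ, α), 0 < y.2 :=
    continuousAt_snd.eventually (lt_mem_nhds h0)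
  have e4 : ∀ᶠ y : ℝ × ℝ in 𝓝 (φ, α), y.2 < Real.pi :=
    continuousAt_snd.eventually (gt_mem_nhds hpi)
  filter_upwards [e1, e2, e3, e4, hc.eventually_apply_implicitFunction one_ne_zero hinv]
    with y y1 y2 y3 y4 y5
  refine (Γ.nextBounce_eq y3 y4 ((Γ.isNextBounce_iff y3 y4).2 ⟨y1, y2, ?_⟩)).symm
  exact y5.trans h3

end SymmetricOval

lemma isBigO_pow_of_tendsto_zero {ι : Type*} {l : Filter ι} {N : ι → ℝ} (hN : Tendsto N l (𝓝 0))
    {j k : ℕ} (hjk : j ≤ k) : (fun i => N i ^ k) =O[l] fun i => N i ^ j := by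
  have h1 : (fun i => N i ^ (k - j)) =O[l] fun _ => (1 : ℝ) :=
    (((isLittleO_one_iff ℝ).2 hN).isBigO.pow (k - j)).congr_right fun _ => one_pow _
  refine ((isBigO_refl (fun i => N i ^ j) l).mul h1).congr (fun i => ?_) fun i => mul_one _
  rw [← pow_add, Nat.add_sub_cancel' hjk]

namespace SymmetricOval

variable {n : ℕ} (Γ : SymmetricOval n)

lemma curve_add_nat_mul (φ : ℝ) (m : ℕ) : Γ.curve (φ + m * (2 * Real.pi / n)) =
    Complex.exp (((m * (2 * Real.pi / n) : ℝ) : ℂ) * Complex.I) * Γ.curve φ := by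
  induction m with
  | zero => simp
  | succ m ih =>
    have : φ + ((m + 1 : ℕ) : ℝ) * (2 * Real.pi / n) =
        φ + m * (2 * Real.pi / n) + 2 * Real.pi / n := by push_cast; ring
    rw [this, Γ.symmetric, ih, ← mul_assoc, exp_mul_I_mul_exp_mul_I]
    congr 4
    push_cast; ring

lemma radius_add_nat_mul (φ : ℝ) (m : ℕ) :
    Γ.radius (φ + m * (2 * Real.pi / n)) = Γ.radius φ := by
  have h : (fun t => Γ.curve (t + m * (2 * Real.pi / n))) = _ :=
    funext fun t => Γ.curve_add_nat_mul t m
  rw [radius, ← deriv_comp_add_const, h, deriv_const_mul _ (Γ.hasDerivAt_curve φ).differentiableAt,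
    norm_mul, Complex.norm_exp_ofReal_mul_I, one_mul, radius]

lemma offset_nextBounce_eventually (φ : ℝ) {α : ℝ} (h0 : 0 < α) (hpi : α < Real.pi) :
    ∀ᶠ y : ℝ × ℝ in 𝓝 (φ, α), Γ.offset (y, Γ.nextBounce y.1 y.2) = 0 := by
  have e3 : ∀ᶠ y : ℝ × ℝ in 𝓝 (φ, α), 0 < y.2 :=
    continuousAt_snd.eventually (lt_mem_nhds h0)
  have e4 : ∀ᶠ y : ℝ × ℝ in 𝓝 (φ, α), y.2 < Real.pi :=
    continuousAt_snd.eventually (gt_mem_nhds hpi)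
  filter_upwards [e3, e4] with y y3 y4
  exact Γ.rayOffset_nextBounce y.1 y3 y4

section fixedPoint

variable {m : ℕ} {φ₀ α : ℝ}

/-- The symmetry gives `Γ(φ₀ + 2α) = e^{2iα}Γ(φ₀)`, and `e^{iα} - e^{-iα} = 2i sin α`; the chord is
thereby expressed through the support function and its derivative. -/
lemma chord_mul_exp (hα : m * (2 * Real.pi / n) = 2 * α) :
    (Γ.curve (φ₀ + 2 * α) - Γ.curve φ₀) * Complex.exp ((-(φ₀ + α) : ℝ) * Complex.I) =
      ((2 * Real.sin α : ℝ) : ℂ) * (Γ.curve φ₀ * Complex.exp ((-φ₀ : ℝ) * Complex.I)) * Complex.I := by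
  have h1 : Complex.exp (((2 * α : ℝ) : ℂ) * Complex.I) =
      Complex.exp ((α : ℂ) * Complex.I) * Complex.exp ((α : ℂ) * Complex.I) := by
    rw [exp_mul_I_mul_exp_mul_I, two_mul]
  have h2 : Complex.exp ((-(φ₀ + α) : ℝ) * Complex.I) = Complex.exp ((-φ₀ : ℝ) * Complex.I) *
      Complex.exp ((-α : ℝ) * Complex.I) := by
    rw [exp_mul_I_mul_exp_mul_I, neg_add]
  have h3 : Complex.exp ((α : ℂ) * Complex.I) * Complex.exp ((-α : ℝ) * Complex.I) = 1 := by
    rw [exp_mul_I_mul_exp_mul_I, add_neg_cancel]; simp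
  have h4 : Complex.exp ((α : ℂ) * Complex.I) - Complex.exp ((-α : ℝ) * Complex.I) =
      ((2 * Real.sin α : ℝ) : ℂ) * Complex.I := by
    rw [Complex.exp_mul_I, Complex.exp_mul_I]
    push_cast
    rw [Complex.cos_neg, Complex.sin_neg]
    ring
  rw [← hα, Γ.curve_add_nat_mul, hα, h1, h2]
  linear_combination (Γ.curve φ₀ * Complex.exp ((-φ₀ : ℝ) * Complex.I)) * h4 +
    (Γ.curve φ₀ * Complex.exp ((-φ₀ : ℝ) * Complex.I)) * Complex.exp ((α : ℂ) * Complex.I) * h3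

lemma nextBounce_eq_of_fixed (hα : m * (2 * Real.pi / n) = 2 * α)
    (h : Γ.quotientMap m (φ₀, α) = (φ₀, α)) : Γ.nextBounce φ₀ α = φ₀ + 2 * α := by
  have h1 := congrArg Prod.fst h
  simp only [quotientMap, billiardMap, Prod.fst_sub] at h1
  have : 2 * Real.pi * m / n = m * (2 * Real.pi / n) := by ring
  linarith

lemma quotientMap_eq (hα : m * (2 * Real.pi / n) = 2 * α) (y : ℝ × ℝ) :
    Γ.quotientMap m y =
      (Γ.nextBounce y.1 y.2 - 2 * α, Γ.nextBounce y.1 y.2 - (y.1 + y.2)) := by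
  have : 2 * Real.pi * m / n = 2 * α := by rw [← hα]; ring
  simp only [quotientMap, billiardMap, this, Prod.mk_sub_mk, sub_zero]

lemma fderiv_offset_fixed (hα : m * (2 * Real.pi / n) = 2 * α) (x β s : ℝ) :
    fderiv ℝ Γ.offset ((φ₀, α), φ₀ + 2 * α) ((x, β), s) =
      Γ.radius φ₀ * Real.sin α * (s + x) - (x + β) * (2 * Real.sin α * Γ.support φ₀) := by
  rw [fderiv_offset, Γ.chord_mul_exp hα, Complex.mul_I_re, Complex.im_ofReal_mul, support_eq,
    show φ₀ + 2 * α - (φ₀ + α) = α by ring, ← hα, radius_add_nat_mul]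
  ring

/-- The derivative of the billiard map at a fixed point of the quotient map. -/
lemma fderiv_nextBounce_fixed (hα : m * (2 * Real.pi / n) = 2 * α) (h0 : 0 < α)
    (hpi : α < Real.pi) (h : Γ.nextBounce φ₀ α = φ₀ + 2 * α) (x β : ℝ) :
    fderiv ℝ (fun y : ℝ × ℝ => Γ.nextBounce y.1 y.2) (φ₀, α) (x, β) =
      -x + 2 * Γ.support φ₀ / Γ.radius φ₀ * (x + β) := by
  obtain ⟨D, hD⟩ := Γ.hasStrictFDerivAt_nextBounce φ₀ h0 hpi
  rw [hD.hasFDerivAt.fderiv]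
  have hF := (Γ.contDiff_offset.differentiable (by simp) ((φ₀, α), φ₀ + 2 * α)).hasFDerivAt
  have hg : HasFDerivAt (fun y : ℝ × ℝ => (y, Γ.nextBounce y.1 y.2)) _ (φ₀, α) :=
    (hasFDerivAt_id (φ₀, α)).prodMk hD.hasFDerivAt
  have hcomp : HasFDerivAt (Γ.offset ∘ fun y : ℝ × ℝ => (y, Γ.nextBounce y.1 y.2))
      ((fderiv ℝ Γ.offset ((φ₀, α), φ₀ + 2 * α)).comp _) (φ₀, α) :=
    HasFDerivAt.comp (φ₀, α) (by simpa only [h] using hF) hg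
  have hzero : HasFDerivAt (Γ.offset ∘ fun y : ℝ × ℝ => (y, Γ.nextBounce y.1 y.2))
      (0 : ℝ × ℝ →L[ℝ] ℝ) (φ₀, α) :=
    (hasFDerivAt_const (0 : ℝ) (φ₀, α)).congr_of_eventuallyEq
      (Γ.offset_nextBounce_eventually φ₀ h0 hpi)
  have := congrArg (fun A : ℝ × ℝ →L[ℝ] ℝ => A (x, β)) (hcomp.unique hzero)
  simp only [ContinuousLinearMap.comp_apply, ContinuousLinearMap.prod_apply,
    zero_apply, ContinuousLinearMap.id_apply] at this
  rw [Γ.fderiv_offset_fixed hα] at this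
  have hS := (Real.sin_pos_of_pos_of_lt_pi h0 hpi).ne'
  have hR := (Γ.radius_pos φ₀).ne'
  field_simp
  have e : Real.sin α * (Γ.radius φ₀ * (D (x, β) + x) - (x + β) * (2 * Γ.support φ₀)) = 0 := by
    linear_combination this
  linear_combination (mul_eq_zero.1 e).resolve_left hS

lemma hasFDerivAt_quotientMap (hα : m * (2 * Real.pi / n) = 2 * α) (h0 : 0 < α)
    (hpi : α < Real.pi) : HasFDerivAt (Γ.quotientMap m)
      ((fderiv ℝ (fun y : ℝ × ℝ => Γ.nextBounce y.1 y.2) (φ₀, α)).prod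
        (fderiv ℝ (fun y : ℝ × ℝ => Γ.nextBounce y.1 y.2) (φ₀, α) -
          (ContinuousLinearMap.fst ℝ ℝ ℝ + ContinuousLinearMap.snd ℝ ℝ ℝ))) (φ₀, α) := by
  obtain ⟨D, hD⟩ := Γ.hasStrictFDerivAt_nextBounce φ₀ h0 hpi
  have hd := hD.hasFDerivAt.differentiableAt.hasFDerivAt
  rw [funext (Γ.quotientMap_eq hα)]
  exact (hd.sub_const _).prodMk (hd.sub (hasFDerivAt_fst.add hasFDerivAt_snd))

end fixedPoint

/-! ### Third-order comparison of the two billiard maps -/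

section comparison

variable {m : ℕ} {φ₀ α ε : ℝ} {h : ℝ → ℝ}

lemma displacement_eventuallyEq (hloc : h =ᶠ[𝓝 φ₀] fun φ => ε * (φ - φ₀) ^ 4) :
    displacement h =ᶠ[𝓝 φ₀] fun φ =>
      ((4 * ε * (φ - φ₀) ^ 3 : ℝ) - ((ε * (φ - φ₀) ^ 4 : ℝ) : ℂ) * Complex.I) *
        Complex.exp (φ * Complex.I) := by
  filter_upwards [hloc.eventuallyEq_nhds] with φ hφ
  have hd : HasDerivAt (fun φ => ε * (φ - φ₀) ^ 4) (4 * ε * (φ - φ₀) ^ 3) φ := by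
    have := ((((hasDerivAt_id φ).sub_const φ₀).pow 4).const_mul ε)
    refine this.congr_deriv ?_
    simp
    ring
  rw [displacement, hφ.deriv_eq, hd.deriv, hφ.eq_of_nhds]

lemma displacement_eventuallyEq_shift (hα : m * (2 * Real.pi / n) = 2 * α)
    (hp : Function.Periodic h (2 * Real.pi / n))
    (hloc : h =ᶠ[𝓝 φ₀] fun φ => ε * (φ - φ₀) ^ 4) :
    displacement h =ᶠ[𝓝 (φ₀ + 2 * α)] fun t =>
      ((4 * ε * (t - (φ₀ + 2 * α)) ^ 3 : ℝ) - ((ε * (t - (φ₀ + 2 * α)) ^ 4 : ℝ) : ℂ) * Complex.I) *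
        Complex.exp (t * Complex.I) := by
  have hp2 : Function.Periodic h (2 * α) := by rw [← hα]; exact hp.nat_mul m
  refine displacement_eventuallyEq ?_
  have ht : Tendsto (fun t => t - 2 * α) (𝓝 (φ₀ + 2 * α)) (𝓝 φ₀) := by
    have : ContinuousAt (fun t : ℝ => t - 2 * α) (φ₀ + 2 * α) := by fun_prop
    simpa [ContinuousAt] using this
  filter_upwards [ht.eventually hloc] with t h1
  rw [← hp2.sub_eq, h1]
  ring

/-- The offset from the ray changes to third order in a way that is explicit. -/
lemma offset_sub_offset_isBigO {Γ' : SymmetricOval n} (hα : m * (2 * Real.pi / n) = 2 * α)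
    (hp : Function.Periodic h (2 * Real.pi / n))
    (hloc : h =ᶠ[𝓝 φ₀] fun φ => ε * (φ - φ₀) ^ 4)
    (hΓ' : ∀ φ, Γ'.curve φ = Γ.curve φ + displacement h φ) {t : ℝ × ℝ → ℝ}
    (ht : (fun y => t y - (φ₀ + 2 * α)) =O[𝓝 (φ₀, α)] fun y => ‖y - (φ₀, α)‖) :
    (fun y => Γ'.offset (y, t y) - Γ.offset (y, t y) -
      4 * ε * Real.sin α * ((t y - (φ₀ + 2 * α)) ^ 3 + (y.1 - φ₀) ^ 3))
      =O[𝓝 (φ₀, α)] fun y => ‖y - (φ₀, α)‖ ^ 4 := by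
  set N : ℝ × ℝ → ℝ := fun y => ‖y - (φ₀, α)‖ with hN
  have hN0 : Tendsto N (𝓝 (φ₀, α)) (𝓝 0) := by
    have : ContinuousAt N (φ₀, α) := by fun_prop
    simpa [ContinuousAt, hN] using this
  have htt : Tendsto t (𝓝 (φ₀, α)) (𝓝 (φ₀ + 2 * α)) := by
    have := (ht.trans_tendsto hN0).add_const (φ₀ + 2 * α)
    simpa using this
  have hx : (fun y : ℝ × ℝ => y.1 - φ₀) =O[𝓝 (φ₀, α)] N :=
    IsBigO.of_bound 1 (Eventually.of_forall fun y => by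
      rw [one_mul, norm_norm]; exact norm_fst_le (y - (φ₀, α)))
  have hb : (fun y : ℝ × ℝ => y.2 - α) =O[𝓝 (φ₀, α)] N :=
    IsBigO.of_bound 1 (Eventually.of_forall fun y => by
      rw [one_mul, norm_norm]; exact norm_snd_le (y - (φ₀, α)))
  have hs1 : (fun y : ℝ × ℝ => Real.sin (t y - (y.1 + y.2)) - Real.sin α) =O[𝓝 (φ₀, α)] N := by
    have h1 : (fun y : ℝ × ℝ => t y - (y.1 + y.2) - α) =O[𝓝 (φ₀, α)] N := by
      refine ((ht.sub hx).sub hb).congr_left fun y => ?_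
      ring
    refine IsBigO.trans (IsBigO.of_bound 1 (Eventually.of_forall fun y => ?_)) h1
    rw [one_mul, Real.norm_eq_abs, Real.norm_eq_abs]
    exact Real.abs_sin_sub_sin_le _ _
  have hs2 : (fun y : ℝ × ℝ => Real.sin (y.1 - (y.1 + y.2)) + Real.sin α) =O[𝓝 (φ₀, α)] N := by
    refine IsBigO.trans (IsBigO.of_bound 1 (Eventually.of_forall fun y => ?_)) hb
    rw [one_mul, Real.norm_eq_abs, Real.norm_eq_abs, show y.1 - (y.1 + y.2) = -y.2 by ring,
      Real.sin_neg, neg_add_eq_sub, abs_sub_comm]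
    exact Real.abs_sin_sub_sin_le _ _
  have hc : ∀ f : ℝ × ℝ → ℝ, (fun y => Real.cos (f y)) =O[𝓝 (φ₀, α)] fun _ => (1 : ℝ) := fun f =>
    IsBigO.of_bound 1 (Eventually.of_forall fun y => by
      simpa using Real.abs_cos_le_one _)
  -- What is left after freezing both sines at the fixed point: cubes times `O(N)` errors of the
  -- sines, and the fourth-order normal displacements.
  have key : (fun y : ℝ × ℝ =>
      4 * ε * ((t y - (φ₀ + 2 * α)) ^ 3 * (Real.sin (t y - (y.1 + y.2)) - Real.sin α)) -
      ε * ((t y - (φ₀ + 2 * α)) ^ 4 * Real.cos (t y - (y.1 + y.2))) -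
      4 * ε * ((y.1 - φ₀) ^ 3 * (Real.sin (y.1 - (y.1 + y.2)) + Real.sin α)) +
      ε * ((y.1 - φ₀) ^ 4 * Real.cos (y.1 - (y.1 + y.2)))) =O[𝓝 (φ₀, α)] fun y => N y ^ 4 := by
    have e3 : ∀ y, N y ^ 3 * N y = N y ^ 4 := fun y => by ring
    have e4 : ∀ y, N y ^ 4 * 1 = N y ^ 4 := fun y => by ring
    refine ((IsBigO.sub ?_ ?_).sub ?_).add ?_
    · exact (((ht.pow 3).mul hs1).congr_right e3).const_mul_left _
    · exact (((ht.pow 4).mul (hc _)).congr_right e4).const_mul_left _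
    · exact (((hx.pow 3).mul hs2).congr_right e3).const_mul_left _
    · exact (((hx.pow 4).mul (hc _)).congr_right e4).const_mul_left _
  refine key.congr' ?_ EventuallyEq.rfl
  have h1 := continuousAt_fst.eventually
    (displacement_eventuallyEq hloc : ∀ᶠ φ in 𝓝 (φ₀, α).1, _)
  filter_upwards [h1, htt.eventually (displacement_eventuallyEq_shift hα hp hloc)] with y h1 h2
  have e : ∀ a b ψ θ : ℝ, (((a : ℂ) - b * Complex.I) * Complex.exp (ψ * Complex.I) *
      Complex.exp ((-θ : ℝ) * Complex.I)).im = a * Real.sin (ψ - θ) - b * Real.cos (ψ - θ) := by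
    intro a b ψ θ
    rw [mul_assoc, exp_mul_I_mul_exp_mul_I, ← sub_eq_add_neg, sub_mul, Complex.sub_im,
      Complex.im_ofReal_mul, mul_assoc, Complex.im_ofReal_mul, mul_comm Complex.I, Complex.mul_I_im,
      Complex.exp_ofReal_mul_I_im, Complex.exp_ofReal_mul_I_re]
  have hdiff : Γ'.offset (y, t y) - Γ.offset (y, t y) =
      (displacement h (t y) * Complex.exp ((-(y.1 + y.2) : ℝ) * Complex.I)).im -
        (displacement h y.1 * Complex.exp ((-(y.1 + y.2) : ℝ) * Complex.I)).im := by
    simp only [offset, rayOffset, hΓ']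
    rw [← Complex.sub_im, ← Complex.sub_im]
    congr 1
    ring
  rw [hdiff, h1, h2, e, e]
  ring

/-- The next bounce changes to third order in a way that is explicit. -/
lemma nextBounce_sub_nextBounce_isBigO {Γ' : SymmetricOval n}
    (hα : m * (2 * Real.pi / n) = 2 * α) (h0 : 0 < α) (hpi : α < Real.pi)
    (hp : Function.Periodic h (2 * Real.pi / n))
    (hloc : h =ᶠ[𝓝 φ₀] fun φ => ε * (φ - φ₀) ^ 4)
    (hΓ' : ∀ φ, Γ'.curve φ = Γ.curve φ + displacement h φ)
    (hfix : Γ.nextBounce φ₀ α = φ₀ + 2 * α) :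
    Γ'.nextBounce φ₀ α = φ₀ + 2 * α ∧
    (fun y : ℝ × ℝ => Γ'.nextBounce y.1 y.2 - (φ₀ + 2 * α))
      =O[𝓝 (φ₀, α)] (fun y => ‖y - (φ₀, α)‖) ∧
    (fun y : ℝ × ℝ => Γ'.nextBounce y.1 y.2 - Γ.nextBounce y.1 y.2)
      =O[𝓝 (φ₀, α)] (fun y => ‖y - (φ₀, α)‖ ^ 3) ∧
    (fun y : ℝ × ℝ => Γ'.nextBounce y.1 y.2 - Γ.nextBounce y.1 y.2 + 4 * ε / Γ.radius φ₀ *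
      ((Γ'.nextBounce y.1 y.2 - (φ₀ + 2 * α)) ^ 3 + (y.1 - φ₀) ^ 3))
      =O[𝓝 (φ₀, α)] fun y => ‖y - (φ₀, α)‖ ^ 4 := by
  have hfix' : Γ'.nextBounce φ₀ α = φ₀ + 2 * α := by
    -- The displacement vanishes at both ends of the chord, so the chord itself is unchanged.
    refine Γ'.nextBounce_eq h0 hpi ((Γ'.isNextBounce_iff h0 hpi).2 ?_)
    have hb := (Γ.isNextBounce_iff h0 hpi).1 (Γ.isNextBounce_nextBounce φ₀ h0 hpi)
    rw [hfix] at hb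
    refine ⟨hb.1, hb.2.1, ?_⟩
    have d1 : displacement h φ₀ = 0 := by
      rw [(displacement_eventuallyEq hloc).eq_of_nhds]; simp
    have d2 : displacement h (φ₀ + 2 * α) = 0 := by
      rw [(displacement_eventuallyEq_shift hα hp hloc).eq_of_nhds]; simp
    rw [← hb.2.2, rayOffset, rayOffset, hΓ', hΓ', d1, d2, add_zero, add_zero]
  set N : ℝ × ℝ → ℝ := fun y => ‖y - (φ₀, α)‖ with hN
  have hN0 : Tendsto N (𝓝 (φ₀, α)) (𝓝 0) := by
    have : ContinuousAt N (φ₀, α) := by fun_prop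
    simpa [ContinuousAt, hN] using this
  have hO : ∀ Δ : SymmetricOval n, Δ.nextBounce φ₀ α = φ₀ + 2 * α →
      (fun y : ℝ × ℝ => Δ.nextBounce y.1 y.2 - (φ₀ + 2 * α)) =O[𝓝 (φ₀, α)] N := by
    intro Δ hΔ
    obtain ⟨D, hD⟩ := Δ.hasStrictFDerivAt_nextBounce φ₀ h0 hpi
    have := hD.hasFDerivAt.isBigO_sub.norm_right
    simpa only [hΔ] using this
  have hO1 := hO Γ hfix
  have hO2 := hO Γ' hfix'
  have hyN : (fun y : ℝ × ℝ => y - (φ₀, α)) =O[𝓝 (φ₀, α)] N := (isBigO_refl _ _).norm_right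
  set δ : ℝ × ℝ → ℝ := fun y => Γ'.nextBounce y.1 y.2 - Γ.nextBounce y.1 y.2 with hδ
  set R := Γ.radius φ₀ with hR
  have hRS : R * Real.sin α ≠ 0 :=
    (mul_pos (Γ.radius_pos φ₀) (Real.sin_pos_of_pos_of_lt_pi h0 hpi)).ne'
  -- The old offset vanishes at the old bounce, so at the new bounce it is linear in `δ` up to
  -- `O(N‖δ‖)`.
  have hmv : (fun y : ℝ × ℝ => Γ.offset (y, Γ'.nextBounce y.1 y.2) - R * Real.sin α * δ y)
      =O[𝓝 (φ₀, α)] fun y => N y * ‖δ y‖ := by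
    have := ContDiffAt.sub_sub_fderiv_isBigO (f := Γ.offset) (x := ((φ₀, α), φ₀ + 2 * α))
      (l := 𝓝 (φ₀, α)) (a := fun y : ℝ × ℝ => (y, Γ'.nextBounce y.1 y.2))
      (b := fun y : ℝ × ℝ => (y, Γ.nextBounce y.1 y.2)) (N := N)
      ((contDiff_infty.1 Γ.contDiff_offset 2)).contDiffAt
      (hyN.prod_left hO2) (hyN.prod_left hO1) hN0
    refine this.congr' ?_ ?_
    · filter_upwards [Γ.offset_nextBounce_eventually φ₀ h0 hpi] with y hy
      have hsub : ((y, Γ'.nextBounce y.1 y.2) - (y, Γ.nextBounce y.1 y.2) : (ℝ × ℝ) × ℝ) =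
        ((0, 0), δ y) := by rw [Prod.mk_sub_mk, sub_self]; rfl
      rw [hy, hsub, Γ.fderiv_offset_fixed hα]
      ring
    · refine Eventually.of_forall fun y => ?_
      have hsub : ((y, Γ'.nextBounce y.1 y.2) - (y, Γ.nextBounce y.1 y.2) : (ℝ × ℝ) × ℝ) =
        (0, δ y) := by simp [hδ]
      simp only [hsub, Prod.norm_mk, norm_zero, sup_of_le_right (norm_nonneg _)]
  have hoff := Γ.offset_sub_offset_isBigO hα hp hloc hΓ' hO2
  have hx : (fun y : ℝ × ℝ => y.1 - φ₀) =O[𝓝 (φ₀, α)] N :=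
    IsBigO.of_bound 1 (Eventually.of_forall fun y => by
      rw [one_mul, norm_norm]; exact norm_fst_le (y - (φ₀, α)))
  have hN43 : (fun y => N y ^ 4) =O[𝓝 (φ₀, α)] fun y => N y ^ 3 :=
    isBigO_pow_of_tendsto_zero hN0 (by norm_num)
  have hE : (fun y : ℝ × ℝ => Γ.offset (y, Γ'.nextBounce y.1 y.2)) =O[𝓝 (φ₀, α)]
      fun y => N y ^ 3 := by
    have h1 := (hoff.trans hN43).add
      (((hO2.pow 3).add (hx.pow 3)).const_mul_left (4 * ε * Real.sin α))
    refine h1.neg_left.congr' ?_ EventuallyEq.rfl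
    filter_upwards [Γ'.offset_nextBounce_eventually φ₀ h0 hpi] with y hy
    rw [hy]
    ring
  -- Bootstrap: the error `N‖δ‖` is negligible against `δ`, so `δ` inherits the cubic bound on the
  -- offset; reinserted in `hmv`, this improves the error to `N ^ 4`.
  have hδ3 : δ =O[𝓝 (φ₀, α)] fun y => N y ^ 3 := by
    have h1 : (fun y : ℝ × ℝ => R * Real.sin α * δ y - Γ.offset (y, Γ'.nextBounce y.1 y.2))
        =o[𝓝 (φ₀, α)] fun y => R * Real.sin α * δ y := by
      refine (hmv.neg_left.congr_left fun y => neg_sub _ _).trans_isLittleO ?_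
      refine IsLittleO.const_mul_right hRS ?_
      have : (fun y => N y * ‖δ y‖) =o[𝓝 (φ₀, α)] fun y => 1 * ‖δ y‖ :=
        ((isLittleO_one_iff ℝ).2 hN0).mul_isBigO (isBigO_refl _ _)
      exact (this.congr_right fun y => one_mul _).of_norm_right
    have h2 := h1.right_isBigO_sub.trans (hE.congr_left fun y => by simp)
    exact (isBigO_const_mul_left_iff hRS).1 h2
  refine ⟨hfix', hO2, hδ3, ?_⟩
  have hmv4 : (fun y : ℝ × ℝ => Γ.offset (y, Γ'.nextBounce y.1 y.2) - R * Real.sin α * δ y)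
      =O[𝓝 (φ₀, α)] fun y => N y ^ 4 :=
    hmv.trans (((isBigO_refl N _).mul hδ3.norm_left).congr_right fun y => by ring)
  refine ((hmv4.add hoff).const_mul_left (-(R * Real.sin α)⁻¹)).congr' ?_ EventuallyEq.rfl
  filter_upwards [Γ'.offset_nextBounce_eventually φ₀ h0 hpi] with y hy
  rw [hy]
  have hS : Real.sin α ≠ 0 := right_ne_zero_of_mul hRS
  have hR0 : R ≠ 0 := left_ne_zero_of_mul hRS
  field_simp
  ring

end comparison

end SymmetricOval

/-! ### Cubic terms of the Birkhoff normal form -/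

/-- The real-homogeneous cubic polynomial with the given coefficients. -/
def complexCubic (A B C D z : ℂ) : ℂ :=
  A * z ^ 3 + B * (z ^ 2 * conj z) + C * (z * conj z ^ 2) + D * conj z ^ 3

section complexCubic

variable {A B C D : ℂ}

lemma contDiff_complexCubic : ContDiff ℝ ∞ (complexCubic A B C D) := by
  have hc : ContDiff ℝ ∞ fun z : ℂ => conj z := Complex.conjCLE.contDiff
  have hi : ContDiff ℝ ∞ fun z : ℂ => z := contDiff_id
  exact (((contDiff_const.mul (hi.pow 3)).add (contDiff_const.mul ((hi.pow 2).mul hc))).add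
    (contDiff_const.mul (hi.mul (hc.pow 2)))).add (contDiff_const.mul (hc.pow 3))

lemma norm_complexCubic_le (z : ℂ) :
    ‖complexCubic A B C D z‖ ≤ (‖A‖ + ‖B‖ + ‖C‖ + ‖D‖) * ‖z‖ ^ 3 := by
  refine (norm_add₄_le).trans (le_of_eq ?_)
  simp only [norm_mul, norm_pow, RCLike.norm_conj]
  ring

lemma complexCubic_zero : complexCubic A B C D 0 = 0 := by simp [complexCubic]

lemma hasFDerivAt_complexCubic : HasFDerivAt (complexCubic A B C D) (0 : ℂ →L[ℝ] ℂ) 0 := by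
  have h : complexCubic A B C D =O[𝓝 0] fun z : ℂ => ‖z - 0‖ ^ 3 :=
    IsBigO.of_bound (‖A‖ + ‖B‖ + ‖C‖ + ‖D‖) (Eventually.of_forall fun z => by
      rw [sub_zero, norm_pow, norm_norm]
      exact norm_complexCubic_le z)
  exact h.hasFDerivAt (by norm_num)

variable {ι : Type*} {l : Filter ι} {p q : ι → ℂ} {N : ι → ℝ}

lemma complexCubic_isBigO (hp : p =O[l] N) :
    (fun i => complexCubic A B C D (p i)) =O[l] fun i => N i ^ 3 := by
  refine IsBigO.trans (IsBigO.of_bound (‖A‖ + ‖B‖ + ‖C‖ + ‖D‖) (Eventually.of_forall fun i => ?_))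
    (hp.pow 3)
  rw [norm_pow]
  exact norm_complexCubic_le _

/-- The derivative of a cubic vanishes at `0`, so a third-order change of its argument is invisible
up to fourth order. -/
lemma complexCubic_sub_isBigO (hN : Tendsto N l (𝓝 0)) (hp : p =O[l] N) (hq : q =O[l] N)
    (hpq : (fun i => p i - q i) =O[l] fun i => N i ^ 3) :
    (fun i => complexCubic A B C D (p i) - complexCubic A B C D (q i)) =O[l] fun i => N i ^ 4 := by
  have h := ContDiffAt.sub_sub_fderiv_isBigO (f := complexCubic A B C D) (x := 0) (a := p) (b := q)
    (contDiff_infty.1 contDiff_complexCubic 2).contDiffAt (hp.congr_left fun i => by simp)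
    (hq.congr_left fun i => by simp) hN
  simp only [hasFDerivAt_complexCubic.fderiv, zero_apply, sub_zero] at h
  exact h.trans (((isBigO_refl N _).mul hpq.norm_left).congr_right fun i => by ring)

end complexCubic

/-- A cubic perturbation of a rotation is brought into Birkhoff normal form by a cubic change of
variables, provided that the rotation is not resonant; here the perturbation is a multiple of the sum of the cubes of two
real functions. -/
lemma exists_birkhoff_normalForm {ι : Type*} {l : Filter ι} {w w' : ι → ℂ} {x x' : ι → ℝ}
    {ζ τ : ℝ} {lam k a : ℂ} (hlam : lam = Complex.exp (ζ * Complex.I)) (h2 : lam ^ 2 ≠ 1)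
    (h4 : lam ^ 4 ≠ 1) (hw : Tendsto (fun i => ‖w i‖) l (𝓝 0))
    (hw' : (fun i => w' i - lam * w i - k * ((x i : ℂ) ^ 3 + (x' i : ℂ) ^ 3)) =O[l] fun i => ‖w i‖ ^ 4)
    (hx : (fun i => (x i : ℂ) - (a * w i + conj (a * w i))) =O[l] fun i => ‖w i‖ ^ 2)
    (hx' : (fun i => (x' i : ℂ) - (a * lam * w i + conj (a * lam * w i))) =O[l] fun i => ‖w i‖ ^ 2)
    (hτ : 3 * k * a ^ 2 * conj a * (1 + lam) = lam * (Complex.I * τ)) :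
    ∃ A C D : ℂ, (fun i => w' i + complexCubic A 0 C D (w' i) -
      Complex.exp (((ζ + τ * ‖w i + complexCubic A 0 C D (w i)‖ ^ 2 : ℝ) : ℂ) * Complex.I) *
        (w i + complexCubic A 0 C D (w i))) =O[l] fun i => ‖w i‖ ^ 4 := by
  have hunit : lam * conj lam = 1 := by
    rw [Complex.mul_conj, Complex.normSq_eq_norm_sq, hlam, Complex.norm_exp_ofReal_mul_I]; simp
  have hl0 : lam ≠ 0 := left_ne_zero_of_mul_eq_one hunit
  set μ := conj lam with hμ
  have d1 : lam ^ 3 - lam ≠ 0 := by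
    have : lam ^ 3 - lam = lam * (lam ^ 2 - 1) := by ring
    rw [this]; exact mul_ne_zero hl0 (sub_ne_zero.2 h2)
  have d2 : μ - lam ≠ 0 := by
    intro h
    apply h2
    have := sub_eq_zero.1 h
    rw [this] at hunit
    rw [sq, hunit]
  have d3 : μ ^ 3 - lam ≠ 0 := by
    intro h
    apply h4
    have h5 : lam = μ ^ 3 := (sub_eq_zero.1 h).symm
    calc lam ^ 4 = lam ^ 3 * lam := by ring
      _ = lam ^ 3 * μ ^ 3 := by rw [← h5]
      _ = (lam * μ) ^ 3 := by ring
      _ = 1 := by rw [hunit, one_pow]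
  set b := conj a with hb
  -- The homological equation, monomial by monomial. The coefficient of `w ^ 2 * conj w` is left at
  -- zero: its divisor `lam ^ 2 * μ - lam` always vanishes, so this term must be absorbed by the
  -- twist.
  set A : ℂ := -(k * a ^ 3 * (1 + lam ^ 3)) / (lam ^ 3 - lam) with hA
  set C : ℂ := -(3 * k * a * b ^ 2 * (1 + μ)) / (μ - lam) with hC
  set D : ℂ := -(k * b ^ 3 * (1 + μ ^ 3)) / (μ ^ 3 - lam) with hD
  have eA : A * (lam ^ 3 - lam) = -(k * a ^ 3 * (1 + lam ^ 3)) := div_mul_cancel₀ _ d1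
  have eC : C * (μ - lam) = -(3 * k * a * b ^ 2 * (1 + μ)) := div_mul_cancel₀ _ d2
  have eD : D * (μ ^ 3 - lam) = -(k * b ^ 3 * (1 + μ ^ 3)) := div_mul_cancel₀ _ d3
  refine ⟨A, C, D, ?_⟩
  set N : ι → ℝ := fun i => ‖w i‖ with hN
  have hwN : w =O[l] N := (isBigO_refl _ _).norm_right
  have hcN : (fun i => conj (w i)) =O[l] N := IsBigO.of_bound 1 (Eventually.of_forall fun i => by
    rw [RCLike.norm_conj, one_mul, norm_norm])
  have hN21 : (fun i => N i ^ 2) =O[l] N :=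
    (isBigO_pow_of_tendsto_zero hw (j := 1) (k := 2) (by norm_num)).congr_right fun i => pow_one _
  have hN31 : (fun i => N i ^ 3) =O[l] N :=
    (isBigO_pow_of_tendsto_zero hw (j := 1) (k := 3) (by norm_num)).congr_right fun i => pow_one _
  have hN43 : (fun i => N i ^ 4) =O[l] fun i => N i ^ 3 :=
    isBigO_pow_of_tendsto_zero hw (by norm_num)
  -- Factoring the difference of cubes shows that a second-order error in `x` costs only fourth
  -- order.
  have hcube : ∀ {x : ι → ℝ} {c : ℂ}, (fun i => (x i : ℂ) - (c * w i + conj (c * w i))) =O[l]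
      (fun i => N i ^ 2) → (fun i => (x i : ℂ)) =O[l] N ∧
      (fun i => (x i : ℂ) ^ 3 - (c * w i + conj (c * w i)) ^ 3) =O[l] fun i => N i ^ 4 := by
    intro x c hx
    have hy : (fun i => c * w i + conj (c * w i)) =O[l] N := by
      simp only [map_mul]
      exact (hwN.const_mul_left c).add (hcN.const_mul_left (conj c))
    have hxN : (fun i => (x i : ℂ)) =O[l] N :=
      ((hx.trans hN21).add hy).congr_left fun i => by ring
    refine ⟨hxN, ?_⟩
    have hs := ((hxN.pow 2).add ((hxN.mul hy).congr_right fun i => (sq (N i)).symm)).add (hy.pow 2)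
    exact (hx.mul hs).congr (fun i => by ring) fun i => by ring
  obtain ⟨hxN, hx3⟩ := hcube hx
  obtain ⟨hxN', hx3'⟩ := hcube hx'
  have hd3 : (fun i => w' i - lam * w i) =O[l] fun i => N i ^ 3 :=
    ((hw'.trans hN43).add (((hxN.pow 3).add (hxN'.pow 3)).const_mul_left k)).congr_left
      fun i => by ring
  have hlw : (fun i => lam * w i) =O[l] N := hwN.const_mul_left lam
  have hw'N : w' =O[l] N := ((hd3.trans hN31).add hlw).congr_left fun i => by ring
  set v : ι → ℂ := fun i => w i + complexCubic A 0 C D (w i) with hv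
  have hvw : (fun i => v i - w i) =O[l] fun i => N i ^ 3 :=
    (complexCubic_isBigO (A := A) (B := 0) (C := C) (D := D) hwN).congr_left fun i => by simp [hv]
  have hvN : v =O[l] N := ((hvw.trans hN31).add hwN).congr_left fun i => by ring
  have t1 : (fun i => complexCubic A 0 C D (w' i) - complexCubic A 0 C D (lam * w i)) =O[l]
      fun i => N i ^ 4 := complexCubic_sub_isBigO hw hw'N hlw hd3
  have t2 : (fun i => complexCubic 0 1 0 0 (v i) - complexCubic 0 1 0 0 (w i)) =O[l]
      fun i => N i ^ 4 := complexCubic_sub_isBigO hw hvN hwN hvw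
  have t3 : (fun i => Complex.exp (((τ * ‖v i‖ ^ 2 : ℝ) : ℂ) * Complex.I) - 1 -
      ((τ * ‖v i‖ ^ 2 : ℝ) : ℂ) * Complex.I) =O[l] fun i => N i ^ 4 := by
    have hs : (fun i => ((τ * ‖v i‖ ^ 2 : ℝ) : ℂ) * Complex.I) =O[l] fun i => N i ^ 2 := by
      have h1 : (fun i => ‖v i‖ ^ 2) =O[l] fun i => N i ^ 2 := hvN.norm_left.pow 2
      refine IsBigO.trans (IsBigO.of_bound |τ| (Eventually.of_forall fun i => ?_)) h1
      rw [norm_mul, Complex.norm_I, mul_one, Complex.norm_real, norm_mul, Real.norm_eq_abs]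
    have hs0 : Tendsto (fun i => ((τ * ‖v i‖ ^ 2 : ℝ) : ℂ) * Complex.I) l (𝓝 0) :=
      (hs.trans hN21).trans_tendsto hw
    have hexp : (fun z : ℂ => Complex.exp z - 1 - z) =O[𝓝 0] fun z => ‖z‖ ^ 2 :=
      IsBigO.of_bound 1 ((Metric.closedBall_mem_nhds (0 : ℂ) one_pos |> eventually_of_mem <| fun z hz => by
        rw [one_mul, norm_pow, norm_norm]
        exact Complex.norm_exp_sub_one_sub_id_le (mem_closedBall_zero_iff.1 hz)))
    have := (hexp.comp_tendsto hs0).trans (hs.norm_left.pow 2)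
    exact this.congr_right fun i => by ring
  have t3' := (t3.mul hvN).trans ((isBigO_pow_of_tendsto_zero hw (j := 4) (k := 5)
    (by norm_num)).congr_left fun i => pow_succ _ _)
  have total := (((hw'.add (((hx3.add hx3').const_mul_left k))).add t1).sub
    (t2.const_mul_left (lam * (Complex.I * τ)))).sub (t3'.const_mul_left lam)
  refine total.congr_left fun i => ?_
  have hexp : Complex.exp (((ζ + τ * ‖v i‖ ^ 2 : ℝ) : ℂ) * Complex.I) =
      lam * Complex.exp (((τ * ‖v i‖ ^ 2 : ℝ) : ℂ) * Complex.I) := by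
    rw [hlam, ← Complex.exp_add, Complex.ofReal_add, add_mul]
  have hnv : ((‖v i‖ ^ 2 : ℝ) : ℂ) * v i = complexCubic 0 1 0 0 (v i) := by
    rw [← Complex.normSq_eq_norm_sq, ← Complex.mul_conj, complexCubic]
    ring
  -- Equality of the cubic jets on both sides; all other contributions are the errors collected in
  -- `total`.
  have halg : lam * w i + k * ((a * w i + conj (a * w i)) ^ 3 +
      (a * lam * w i + conj (a * lam * w i)) ^ 3) + complexCubic A 0 C D (lam * w i) =
      lam * v i + lam * (Complex.I * τ) * complexCubic 0 1 0 0 (w i) := by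
    simp only [hv, complexCubic, map_mul, ← hμ, ← hb]
    linear_combination w i ^ 3 * eA + w i * conj (w i) ^ 2 * eC + conj (w i) ^ 3 * eD +
      w i ^ 2 * conj (w i) * hτ + (3 * k * a ^ 2 * b * lam * w i ^ 2 * conj (w i) +
        (3 * k * a * b ^ 2 * μ + C * μ) * w i * conj (w i) ^ 2) * hunit
  have hvi : w i + complexCubic A 0 C D (w i) = v i := rfl
  rw [hvi, hexp]
  generalize Complex.exp (((τ * ‖v i‖ ^ 2 : ℝ) : ℂ) * Complex.I) = E
  rw [Complex.ofReal_mul]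
  linear_combination (lam * Complex.I * τ) * hnv - halg + hvi

/-- If the two components of a complex linear form span the plane and the form is an eigenform of the derivative
of the billiard map, then the derivative is an elliptic rotation. -/
lemma exists_rotation_angle {u v lam : ℂ} {q : ℝ} (hdet : u.re * v.im - u.im * v.re ≠ 0)
    (e1 : u * (q - 1) + v * (q - 2) = lam * u) (e2 : u * q + v * (q - 1) = lam * v) :
    ∃ σ : ℝ, σ ≠ 0 ∧ q ≠ 0 ∧ q ≠ 2 ∧ lam = q - 1 + σ * Complex.I ∧ σ ^ 2 = q * (2 - q) ∧
      u * q = σ * Complex.I * v := by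
  have hv : v ≠ 0 := by
    rintro rfl
    simp at hdet
  -- Half the trace is subtracted: `d ^ 2 = q * (q - 2)` is real, so `d` is real or purely
  -- imaginary.
  set d := lam - (q - 1) with hd
  have d1 : d * u = (q - 2) * v := by rw [hd]; linear_combination -e1
  have d2 : d * v = q * u := by rw [hd]; linear_combination -e2
  have hsq : d ^ 2 = ((q * (q - 2) : ℝ) : ℂ) := by
    apply mul_right_cancel₀ hv
    push_cast
    linear_combination d * d2 + q * d1
  have him : d.re * d.im = 0 := by
    have := congrArg Complex.im hsq
    rw [sq, Complex.mul_im, Complex.ofReal_im] at this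
    linarith
  have hre2 : d.re ^ 2 - d.im ^ 2 = q * (q - 2) := by
    have := congrArg Complex.re hsq
    rw [sq, Complex.mul_re, Complex.ofReal_re] at this
    linarith
  -- For real `d`, the relation `d * v = q * u` and the independence of `u` and `v` over the reals
  -- give `q = 0`, hence `d = 0` and then `v = 0`.
  have him0 : d.im ≠ 0 := by
    intro h0
    have r1 := congrArg Complex.re d2
    have r2 := congrArg Complex.im d2
    rw [Complex.mul_re, Complex.re_ofReal_mul, h0] at r1
    rw [Complex.mul_im, Complex.im_ofReal_mul, h0] at r2
    have hq : q = 0 := by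
      have : q * (u.re * v.im - u.im * v.re) = 0 := by
        linear_combination -v.im * r1 + v.re * r2
      exact (mul_eq_zero.1 this).resolve_right hdet
    have hd0 : d = 0 := by
      rw [hq] at hre2
      refine Complex.ext ?_ h0
      have : d.re ^ 2 = 0 := by rw [h0] at hre2; linarith
      exact pow_eq_zero_iff two_ne_zero |>.1 this
    rw [hd0, hq] at d1
    exact hv (by simpa using d1)
  have hre : d.re = 0 := (mul_eq_zero.1 him).resolve_right him0
  have hσ : d.im ^ 2 = q * (2 - q) := by rw [hre] at hre2; linarith
  have hdI : d = d.im * Complex.I := Complex.ext (by simp [hre]) (by simp)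
  have hσ0 : d.im ^ 2 ≠ 0 := pow_ne_zero 2 him0
  refine ⟨d.im, him0, ?_, ?_, ?_, hσ, ?_⟩
  · rintro rfl; exact hσ0 (by rw [hσ, zero_mul])
  · rintro rfl; exact hσ0 (by rw [hσ]; ring)
  · rw [← hdI, hd]; ring
  · rw [← hdI, d2]; ring

/-- The eigenvalue of an eigenform is a multiplier. -/
lemma isMultiplier_of_eigenform {F : ℝ × ℝ → ℝ × ℝ} {x : ℝ × ℝ} {lam : ℂ} (l : ℝ × ℝ →ₗ[ℝ] ℂ)
    (h0 : l ≠ 0) (h : ∀ v, l (fderiv ℝ F x v) = lam * l v) : IsMultiplier F x lam := by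
  set f : ℝ × ℝ →ₗ[ℝ] ℝ × ℝ := (fderiv ℝ F x : ℝ × ℝ →ₗ[ℝ] ℝ × ℝ) with hf
  -- The form intertwines the derivative with multiplication by `lam`, hence also their polynomials;
  -- Cayley–Hamilton then makes `lam` a root.
  have key : ∀ (p : Polynomial ℝ) (v : ℝ × ℝ),
      l (Polynomial.aeval f p v) = Polynomial.aeval lam p * l v := by
    intro p
    induction p using Polynomial.induction_on' with
    | add p q hp hq =>
      intro v
      rw [map_add, map_add, LinearMap.add_apply, map_add, hp, hq, add_mul]
    | monomial k c =>
      intro v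
      rw [Polynomial.aeval_monomial, Polynomial.aeval_monomial, mul_assoc]
      have hk : ∀ v, l ((f ^ k) v) = lam ^ k * l v := by
        induction k with
        | zero => intro v; simp
        | succ k ih =>
          intro v
          rw [pow_succ, Module.End.mul_apply, ih, pow_succ, mul_assoc]
          congr 1
          exact h v
      rw [← hk, Module.End.mul_apply, Module.algebraMap_end_apply, map_smul, Algebra.smul_def]
  obtain ⟨v, hv⟩ : ∃ v, l v ≠ 0 := by
    by_contra! hcon
    exact h0 (LinearMap.ext hcon)
  have := key f.charpoly v
  rw [LinearMap.aeval_self_charpoly, LinearMap.zero_apply, map_zero] at this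
  have h1 := (mul_eq_zero.1 this.symm).resolve_right hv
  rw [IsMultiplier, Polynomial.IsRoot.def, Polynomial.eval_map_algebraMap]
  exact h1

lemma hasFDerivAt_comp_fst {f : ℝ → ℝ} {d : ℝ} {p : ℝ × ℝ} (h : HasDerivAt f d p.1) :
    HasFDerivAt (fun p : ℝ × ℝ => f p.1) (d • ContinuousLinearMap.fst ℝ ℝ ℝ) p := by
  have hf : HasFDerivAt (fun p : ℝ × ℝ => p.1) (ContinuousLinearMap.fst ℝ ℝ ℝ) p := hasFDerivAt_fst
  exact h.comp_hasFDerivAt p hf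

lemma hasFDerivAt_comp_snd {f : ℝ → ℝ} {d : ℝ} {p : ℝ × ℝ} (h : HasDerivAt f d p.2) :
    HasFDerivAt (fun p : ℝ × ℝ => f p.2) (d • ContinuousLinearMap.snd ℝ ℝ ℝ) p := by
  have hf : HasFDerivAt (fun p : ℝ × ℝ => p.2) (ContinuousLinearMap.snd ℝ ℝ ℝ) p := hasFDerivAt_snd
  exact h.comp_hasFDerivAt p hf

/-! ### Canonical variables and the linearizing coordinate -/

namespace SymmetricOval

variable {n : ℕ} (Γ : SymmetricOval n)

section canonical

lemma contDiff_canonical : ContDiff ℝ ∞ Γ.canonical :=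
  (Γ.contDiff_arclength.comp contDiff_fst).prodMk (Real.contDiff_cos.comp contDiff_snd)

lemma hasFDerivAt_canonical (φ α : ℝ) : HasFDerivAt Γ.canonical
    ((Γ.radius φ • ContinuousLinearMap.fst ℝ ℝ ℝ).prod
      ((-Real.sin α) • ContinuousLinearMap.snd ℝ ℝ ℝ)) (φ, α) := by
  exact (hasFDerivAt_comp_fst (Γ.hasDerivAt_arclength φ)).prodMk
    (hasFDerivAt_comp_snd (Real.hasDerivAt_cos α))

/-- The transition from the canonical variables of `Γ'` to those of `Γ`. -/
def canonicalTransition (Γ' : SymmetricOval n) (p : ℝ × ℝ) : ℝ × ℝ :=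
  (Γ.arclength (Γ'.arclengthHomeomorph.symm p.1), p.2)

variable (Γ' : SymmetricOval n)

lemma canonicalTransition_canonical (y : ℝ × ℝ) :
    Γ.canonicalTransition Γ' (Γ'.canonical y) = Γ.canonical y := by
  have : Γ'.arclengthHomeomorph.symm (Γ'.arclength y.1) = y.1 :=
    Γ'.arclengthHomeomorph.symm_apply_apply y.1
  simp only [canonicalTransition, canonical, this]

lemma contDiff_canonicalTransition : ContDiff ℝ ∞ (Γ.canonicalTransition Γ') :=
  (Γ.contDiff_arclength.comp (Γ'.contDiff_arclengthHomeomorph_symm.comp contDiff_fst)).prodMk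
    contDiff_snd

/-- The derivative in arclength is the ratio of the two radii, here one; this preserves the Jacobian
condition on `Ψ`. -/
lemma hasFDerivAt_canonicalTransition {φ α : ℝ} (hR : Γ'.radius φ = Γ.radius φ) :
    HasFDerivAt (Γ.canonicalTransition Γ') (ContinuousLinearMap.id ℝ (ℝ × ℝ))
      (Γ'.canonical (φ, α)) := by
  have h1 : HasDerivAt (fun s => Γ.arclength (Γ'.arclengthHomeomorph.symm s)) 1
      (Γ'.arclength φ) := by
    have e : Γ'.arclengthHomeomorph.symm (Γ'.arclength φ) = φ :=
      Γ'.arclengthHomeomorph.symm_apply_apply φ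
    have := HasDerivAt.comp_of_eq (Γ'.arclength φ) (Γ.hasDerivAt_arclength φ)
      (Γ'.hasDerivAt_arclengthHomeomorph_symm φ) e.symm
    rwa [hR, mul_inv_cancel₀ (Γ.radius_pos φ).ne'] at this
  have h2 := hasFDerivAt_comp_fst (p := Γ'.canonical (φ, α)) h1
  have h3 : HasFDerivAt (fun p : ℝ × ℝ => p.2) (ContinuousLinearMap.snd ℝ ℝ ℝ)
      (Γ'.canonical (φ, α)) := hasFDerivAt_snd
  refine (h2.prodMk h3).congr_fderiv ?_
  ext <;> simp

end canonical

section twist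

variable {m : ℕ} {φ₀ α : ℝ}

/-- The normal form with zero twist, expressed in the variables `(φ, α)`. -/
lemma exists_linearization (hα : m * (2 * Real.pi / n) = 2 * α) (h0 : 0 < α) (hpi : α < Real.pi)
    (hfix : Γ.nextBounce φ₀ α = φ₀ + 2 * α) {Ψ : ℝ × ℝ → ℂ} {ζ : ℝ}
    (hΨ : ContDiffAt ℝ ∞ Ψ (Γ.canonical (φ₀, α))) (hΨ0 : Ψ (Γ.canonical (φ₀, α)) = 0)
    (hdet : (fderiv ℝ Ψ (Γ.canonical (φ₀, α)) (1, 0)).re *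
        (fderiv ℝ Ψ (Γ.canonical (φ₀, α)) (0, 1)).im -
      (fderiv ℝ Ψ (Γ.canonical (φ₀, α)) (1, 0)).im *
        (fderiv ℝ Ψ (Γ.canonical (φ₀, α)) (0, 1)).re = 1)
    (hO : (fun y => Ψ (Γ.canonical (Γ.quotientMap m y)) -
      Complex.exp (ζ * Complex.I) * Ψ (Γ.canonical y))
      =O[𝓝 (φ₀, α)] fun y => ‖Ψ (Γ.canonical y)‖ ^ 4) :
    ∃ (u v : ℂ) (L : ℝ × ℝ →L[ℝ] ℂ), HasFDerivAt (fun y => Ψ (Γ.canonical y)) L (φ₀, α) ∧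
      (∀ x β : ℝ, L (x, β) = x * u + β * v) ∧ u.re * v.im - u.im * v.re ≠ 0 ∧
      (∀ y, L (fderiv ℝ (Γ.quotientMap m) (φ₀, α) y) = Complex.exp (ζ * Complex.I) * L y) ∧
      u * ((2 * Γ.support φ₀ / Γ.radius φ₀ : ℝ) - 1) + v * ((2 * Γ.support φ₀ / Γ.radius φ₀ : ℝ) - 2)
        = Complex.exp (ζ * Complex.I) * u ∧
      u * (2 * Γ.support φ₀ / Γ.radius φ₀ : ℝ) + v * ((2 * Γ.support φ₀ / Γ.radius φ₀ : ℝ) - 1)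
        = Complex.exp (ζ * Complex.I) * v := by
  set P := fderiv ℝ Ψ (Γ.canonical (φ₀, α)) with hP
  set q : ℝ := 2 * Γ.support φ₀ / Γ.radius φ₀ with hq
  have hΨd : HasFDerivAt Ψ P (Γ.canonical (φ₀, α)) :=
    (hΨ.differentiableAt (by simp)).hasFDerivAt
  have hw : HasFDerivAt (fun y => Ψ (Γ.canonical y)) _ (φ₀, α) :=
    HasFDerivAt.comp (φ₀, α) hΨd (Γ.hasFDerivAt_canonical φ₀ α)
  set L := P.comp ((Γ.radius φ₀ • ContinuousLinearMap.fst ℝ ℝ ℝ).prod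
      ((-Real.sin α) • ContinuousLinearMap.snd ℝ ℝ ℝ)) with hL
  have hPlin : ∀ x β : ℝ, P (x, β) = x * P (1, 0) + β * P (0, 1) := fun x β => by
    have : ((x, β) : ℝ × ℝ) = x • (1, 0) + β • (0, 1) := by simp
    rw [this, map_add, map_smul, map_smul, Complex.real_smul, Complex.real_smul]
  have hLlin : ∀ x β : ℝ, L (x, β) = x * (Γ.radius φ₀ * P (1, 0)) + β * (-Real.sin α * P (0, 1)) := by
    intro x β
    simp only [hL, ContinuousLinearMap.comp_apply, ContinuousLinearMap.prod_apply,
      smul_apply, ContinuousLinearMap.coe_fst', ContinuousLinearMap.coe_snd',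
      smul_eq_mul]
    rw [hPlin]
    push_cast
    ring
  have hT : HasFDerivAt (Γ.quotientMap m) (fderiv ℝ (Γ.quotientMap m) (φ₀, α)) (φ₀, α) :=
    (Γ.hasFDerivAt_quotientMap hα h0 hpi).differentiableAt.hasFDerivAt
  have hTfix : Γ.quotientMap m (φ₀, α) = (φ₀, α) := by
    rw [Γ.quotientMap_eq hα, hfix]
    ext <;> simp; ring
  have heig : ∀ y, L (fderiv ℝ (Γ.quotientMap m) (φ₀, α) y) = Complex.exp (ζ * Complex.I) * L y := by
    have hwT : HasFDerivAt (fun y => Ψ (Γ.canonical (Γ.quotientMap m y)))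
        (L.comp (fderiv ℝ (Γ.quotientMap m) (φ₀, α))) (φ₀, α) :=
      HasFDerivAt.comp (g := fun y => Ψ (Γ.canonical y)) (φ₀, α) (by rw [hTfix]; exact hw) hT
    have hd := hwT.sub (hw.const_mul (Complex.exp (ζ * Complex.I)))
    -- An error of fourth order has zero derivative, so the normal form yields an exact eigenform.
    have hzero : HasFDerivAt (fun y => Ψ (Γ.canonical (Γ.quotientMap m y)) -
        Complex.exp (ζ * Complex.I) * Ψ (Γ.canonical y)) (0 : ℝ × ℝ →L[ℝ] ℂ) (φ₀, α) := by
      have h1 : (fun y => Ψ (Γ.canonical y)) =O[𝓝 (φ₀, α)] fun y => ‖y - (φ₀, α)‖ := by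
        have := hw.isBigO_sub.norm_right
        simpa only [hΨ0, sub_zero] using this
      exact (hO.trans (h1.norm_left.pow 4)).hasFDerivAt (by norm_num)
    intro y
    have := congrArg (fun A : ℝ × ℝ →L[ℝ] ℂ => A y) (hd.unique hzero)
    simpa [sub_eq_zero] using this
  refine ⟨Γ.radius φ₀ * P (1, 0), -Real.sin α * P (0, 1), L, hw, hLlin, ?_, heig, ?_, ?_⟩
  · have hne : Γ.radius φ₀ * Real.sin α ≠ 0 :=
      (mul_pos (Γ.radius_pos φ₀) (Real.sin_pos_of_pos_of_lt_pi h0 hpi)).ne'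
    rw [← Complex.ofReal_neg, Complex.re_ofReal_mul, Complex.re_ofReal_mul, Complex.im_ofReal_mul,
      Complex.im_ofReal_mul]
    intro h
    apply hne
    linear_combination -h - Γ.radius φ₀ * Real.sin α * hdet
  all_goals
    have hM : ∀ x β : ℝ, fderiv ℝ (Γ.quotientMap m) (φ₀, α) (x, β) =
        (-x + q * (x + β), -x + q * (x + β) - (x + β)) := fun x β => by
      rw [(Γ.hasFDerivAt_quotientMap hα h0 hpi).fderiv]
      simp [Γ.fderiv_nextBounce_fixed hα h0 hpi hfix, hq]
  · have := heig (1, 0)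
    rw [hM, hLlin, hLlin] at this
    push_cast at this ⊢
    linear_combination this
  · have := heig (0, 1)
    rw [hM, hLlin, hLlin] at this
    push_cast at this ⊢
    linear_combination this

end twist

end SymmetricOval

/-! ### Effect of the perturbation on the multipliers and the twist -/

namespace SymmetricOval

variable {n : ℕ} (Γ : SymmetricOval n) {m : ℕ} {φ₀ α ε : ℝ} {h : ℝ → ℝ}

/-- A perturbation of the fourth order of the support function does not change the derivative at the fixed point. -/
lemma hasFDerivAt_quotientMap_of_perturb {Γ' : SymmetricOval n}
    (hα : m * (2 * Real.pi / n) = 2 * α) (h0 : 0 < α) (hpi : α < Real.pi)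
    (hp : Function.Periodic h (2 * Real.pi / n))
    (hloc : h =ᶠ[𝓝 φ₀] fun φ => ε * (φ - φ₀) ^ 4)
    (hΓ' : ∀ φ, Γ'.curve φ = Γ.curve φ + displacement h φ)
    (hfix : Γ.nextBounce φ₀ α = φ₀ + 2 * α) :
    HasFDerivAt (Γ'.quotientMap m) (fderiv ℝ (Γ.quotientMap m) (φ₀, α)) (φ₀, α) := by
  obtain ⟨-, -, h3, -⟩ := Γ.nextBounce_sub_nextBounce_isBigO hα h0 hpi hp hloc hΓ' hfix
  have hd : HasFDerivAt (fun y : ℝ × ℝ => Γ'.nextBounce y.1 y.2 - Γ.nextBounce y.1 y.2)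
      (0 : ℝ × ℝ →L[ℝ] ℝ) (φ₀, α) := h3.hasFDerivAt (by norm_num)
  have hT : HasFDerivAt (Γ.quotientMap m) (fderiv ℝ (Γ.quotientMap m) (φ₀, α)) (φ₀, α) :=
    (Γ.hasFDerivAt_quotientMap hα h0 hpi).differentiableAt.hasFDerivAt
  refine ((hT.add (hd.prodMk hd)).congr_of_eventuallyEq (Eventually.of_forall fun y => ?_)).congr_fderiv ?_
  · simp only [Pi.add_apply, Γ.quotientMap_eq hα, Γ'.quotientMap_eq hα, Prod.mk_add_mk]
    ext <;> simp only <;> ring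
  · ext <;> simp

/-- Where the normal form with zero twist exists, the second derivative of the support function does not vanish. -/
lemma radius_ne_support_of_hasTwistCoefficient (hα : m * (2 * Real.pi / n) = 2 * α) (h0 : 0 < α)
    (hpi : α < Real.pi) (hfix : Γ.nextBounce φ₀ α = φ₀ + 2 * α)
    (hτ : Γ.HasTwistCoefficient (Γ.quotientMap m) (φ₀, α) 0) : Γ.radius φ₀ ≠ Γ.support φ₀ := by
  obtain ⟨U, Ψ, ζ, hU, hmem, hΨ, hΨ0, hdet, hO⟩ := hτ
  simp only [zero_mul, add_zero] at hO
  obtain ⟨u, v, -, -, -, huv, -, e1, e2⟩ :=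
    Γ.exists_linearization hα h0 hpi hfix (hΨ.contDiffAt (hU.mem_nhds hmem)) hΨ0 hdet hO
  obtain ⟨-, -, -, hq, -⟩ := exists_rotation_angle huv e1 e2
  refine fun hcon => hq ?_
  rw [← hcon, mul_div_cancel_right₀ _ (Γ.radius_pos φ₀).ne']

/-- A perturbation of the fourth order of the support function makes a vanishing twist coefficient nonzero. -/
lemma hasTwistCoefficient_of_perturb {Γ' : SymmetricOval n}
    (hα : m * (2 * Real.pi / n) = 2 * α) (h0 : 0 < α) (hpi : α < Real.pi)
    (hp : Function.Periodic h (2 * Real.pi / n))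
    (hloc : h =ᶠ[𝓝 φ₀] fun φ => ε * (φ - φ₀) ^ 4) (hε : ε ≠ 0)
    (hΓ' : ∀ φ, Γ'.curve φ = Γ.curve φ + displacement h φ) (hR : Γ'.radius φ₀ = Γ.radius φ₀)
    (hfix : Γ.nextBounce φ₀ α = φ₀ + 2 * α)
    (hres : IsNonResonant (Γ.quotientMap m) (φ₀, α))
    (hτ : Γ.HasTwistCoefficient (Γ.quotientMap m) (φ₀, α) 0) :
    ∃ τ : ℝ, τ ≠ 0 ∧ Γ'.HasTwistCoefficient (Γ'.quotientMap m) (φ₀, α) τ := by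
  obtain ⟨U, Ψ, ζ, hU, hmem, hΨ, hΨ0, hdet, hO⟩ := hτ
  simp only [zero_mul, add_zero] at hO
  have hΨat : ContDiffAt ℝ ∞ Ψ (Γ.canonical (φ₀, α)) := hΨ.contDiffAt (hU.mem_nhds hmem)
  obtain ⟨u, v, L, hw, hL, huv, heig, e1, e2⟩ :=
    Γ.exists_linearization hα h0 hpi hfix hΨat hΨ0 hdet hO
  have hR0 := (Γ.radius_pos φ₀).ne'
  set q : ℝ := 2 * Γ.support φ₀ / Γ.radius φ₀ with hq
  set lam := Complex.exp (ζ * Complex.I) with hlam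
  obtain ⟨σ, hσ, hq0, -, hlamq, hσ2, huq⟩ := exists_rotation_angle huv e1 e2
  have hv : v ≠ 0 := by
    rintro rfl
    simp at huv
  have hσC : (σ : ℂ) ≠ 0 := Complex.ofReal_ne_zero.2 hσ
  have hmult : IsMultiplier (Γ.quotientMap m) (φ₀, α) lam := by
    refine isMultiplier_of_eigenform (L : ℝ × ℝ →ₗ[ℝ] ℂ) (fun h => ?_) heig
    have := congrArg (fun A : ℝ × ℝ →ₗ[ℝ] ℂ => A (0, 1)) h
    simp only [ContinuousLinearMap.coe_coe, hL] at this
    exact hv (by simpa using this)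
  have hlam2 : lam ^ 2 ≠ 1 := hres lam hmult 2 (by simp)
  have hlam4 : lam ^ 4 ≠ 1 := hres lam hmult 4 (by simp)
  obtain ⟨hfix', hO2, hδ3, hδ4⟩ := Γ.nextBounce_sub_nextBounce_isBigO hα h0 hpi hp hloc hΓ' hfix
  set w : ℝ × ℝ → ℂ := fun y => Ψ (Γ.canonical y) with hwdef
  set N : ℝ × ℝ → ℝ := fun y => ‖y - (φ₀, α)‖ with hN
  set l : Filter (ℝ × ℝ) := 𝓝 (φ₀, α) with hl
  have hN0 : Tendsto N l (𝓝 0) := by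
    have : ContinuousAt N (φ₀, α) := by fun_prop
    simpa [ContinuousAt, hN] using this
  have hyN : (fun y : ℝ × ℝ => y - (φ₀, α)) =O[l] N := (isBigO_refl _ _).norm_right
  have hwN : w =O[l] N := by
    have := hw.isBigO_sub.norm_right
    simpa only [hwdef, hΨ0, sub_zero] using this
  have hwC2 : ContDiffAt ℝ 2 w (φ₀, α) :=
    contDiffAt_infty.1 (hΨat.comp (φ₀, α) Γ.contDiff_canonical.contDiffAt) 2
  have hfw : fderiv ℝ w (φ₀, α) = L := hw.fderiv
  -- the coordinate `φ` in terms of the linearizing variable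
  set a : ℂ := q / (2 * Complex.I * σ * v) with ha
  have haL : ∀ p : ℝ × ℝ, a * L p + conj (a * L p) = p.1 := by
    rintro ⟨x, β⟩
    have e : a * L (x, β) = ((x / 2 : ℝ) : ℂ) - ((q * β / (2 * σ) : ℝ) : ℂ) * Complex.I := by
      have : a * L (x, β) = (x * (u * q) + q * β * v) / (2 * Complex.I * σ * v) := by
        rw [ha, hL]; ring
      rw [this, huq]
      have hI := Complex.I_ne_zero
      push_cast
      field_simp
      linear_combination (q * β : ℂ) * Complex.I_sq
    rw [e, Complex.add_conj, Complex.sub_re, Complex.ofReal_re, Complex.re_ofReal_mul, Complex.I_re]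
    push_cast
    ring
  -- Stated along an arbitrary `b` because it serves for the point itself and for its image under
  -- the perturbed map.
  have hlin : ∀ b : ℝ × ℝ → ℝ × ℝ, (fun y => b y - (φ₀, α)) =O[l] N →
      (fun y => (((b y).1 - φ₀ : ℝ) : ℂ) - (a * w (b y) + conj (a * w (b y)))) =O[l]
        fun y => N y ^ 2 := by
    intro b hb
    have h1 := ContDiffAt.sub_sub_fderiv_isBigO hwC2 hb (b := fun _ => (φ₀, α))
      (by simpa using isBigO_zero N l) hN0
    have hw0 : w (φ₀, α) = 0 := hΨ0
    simp only [hw0, sub_zero, hfw] at h1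
    have h2 := (h1.trans (((isBigO_refl N l).mul hb.norm_left).congr_right
      fun y => (sq (N y)).symm)).const_mul_left a
    have h3 : (fun y => conj (a * (w (b y) - L (b y - (φ₀, α))))) =O[l] fun y => N y ^ 2 :=
      (IsBigO.of_bound 1 (Eventually.of_forall fun y => by
        rw [RCLike.norm_conj, one_mul])).trans h2
    refine (h2.add h3).neg_left.congr_left fun y => ?_
    have := haL (b y - (φ₀, α))
    simp only [mul_sub, map_sub, Prod.fst_sub] at this ⊢
    linear_combination this
  -- The form `L` is injective, so errors measured by the distance to the fixed point are also
  -- errors in `‖w‖`.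
  have hNw : N =O[l] w := by
    have hker : (L : ℝ × ℝ →ₗ[ℝ] ℂ).ker = ⊥ := by
      rw [LinearMap.ker_eq_bot']
      rintro ⟨x, β⟩ hz
      have hz' : L (x, β) = 0 := hz
      have hx := haL (x, β)
      rw [hz'] at hx
      have hx0 : x = 0 := by simpa using hx.symm
      rw [hL, hx0] at hz'
      have hβ : β = 0 := by simpa [hv] using hz'
      rw [hx0, hβ]; rfl
    obtain ⟨K, -, hK⟩ := LinearMap.exists_antilipschitzWith _ hker
    have h1 : (fun y => y - (φ₀, α)) =O[l] fun y => L (y - (φ₀, α)) :=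
      IsBigO.of_bound K (Eventually.of_forall fun y => by
        simpa [dist_eq_norm] using hK.le_mul_dist (y - (φ₀, α)) 0)
    have h2 : (fun y => w y - L (y - (φ₀, α))) =o[l] fun y => L (y - (φ₀, α)) := by
      have := hw.isLittleO
      simp only [hwdef, hΨ0, sub_zero] at this
      exact this.trans_isBigO h1
    exact (h1.trans (h2.right_isBigO_add.congr_right fun y => by simp)).norm_left
  have hww : ∀ k : ℕ, (fun y => N y ^ k) =O[l] fun y => ‖w y‖ ^ k := fun k => hNw.norm_right.pow k
  -- the perturbed map
  set T := Γ.quotientMap m with hT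
  set T' := Γ'.quotientMap m with hT'
  have hTfix : T (φ₀, α) = (φ₀, α) := by
    rw [hT, Γ.quotientMap_eq hα, hfix]
    ext <;> simp; ring
  have hTfix' : T' (φ₀, α) = (φ₀, α) := by
    rw [hT', Γ'.quotientMap_eq hα, hfix']
    ext <;> simp; ring
  have hTd : HasFDerivAt T (fderiv ℝ T (φ₀, α)) (φ₀, α) :=
    (Γ.hasFDerivAt_quotientMap hα h0 hpi).differentiableAt.hasFDerivAt
  have hTd' : HasFDerivAt T' (fderiv ℝ T (φ₀, α)) (φ₀, α) :=
    Γ.hasFDerivAt_quotientMap_of_perturb hα h0 hpi hp hloc hΓ' hfix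
  have hTN : (fun y => T y - (φ₀, α)) =O[l] N := by
    have := hTd.isBigO_sub.norm_right
    rwa [hTfix] at this
  have hTN' : (fun y => T' y - (φ₀, α)) =O[l] N := by
    have := hTd'.isBigO_sub.norm_right
    rwa [hTfix'] at this
  set δ : ℝ × ℝ → ℝ := fun y => Γ'.nextBounce y.1 y.2 - Γ.nextBounce y.1 y.2 with hδ
  have hTT : ∀ y, T' y - T y = (δ y, δ y) := fun y => by
    rw [hT, hT', Γ.quotientMap_eq hα, Γ'.quotientMap_eq hα]
    ext <;> simp [hδ]
  set x : ℝ × ℝ → ℝ := fun y => y.1 - φ₀ with hx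
  set x' : ℝ × ℝ → ℝ := fun y => Γ'.nextBounce y.1 y.2 - (φ₀ + 2 * α) with hx'
  have hx'T : ∀ y, x' y = (T' y).1 - φ₀ := fun y => by
    rw [hT', Γ'.quotientMap_eq hα]; simp only [hx']; ring
  -- Both components of the map shift by the same `δ`, and `L (δ, δ) = δ * (u + v)`.
  set k : ℂ := -(4 * ε / Γ.radius φ₀ : ℝ) * (u + v) with hk
  have hmain : (fun y => w (T' y) - lam * w y - k * ((x y : ℂ) ^ 3 + (x' y : ℂ) ^ 3)) =O[l]
      fun y => N y ^ 4 := by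
    have h1 := ContDiffAt.sub_sub_fderiv_isBigO hwC2 hTN' hTN hN0
    have h2 : (fun y => N y * ‖T' y - T y‖) =O[l] fun y => N y ^ 4 := by
      refine ((isBigO_refl N l).mul hδ3.norm_left).congr (fun y => ?_) fun y => by ring
      rw [hTT, Prod.norm_mk, max_self]
    have h3 : (fun y => ((δ y + 4 * ε / Γ.radius φ₀ * (x' y ^ 3 + x y ^ 3) : ℝ) : ℂ) * (u + v)) =O[l]
        fun y => N y ^ 4 := by
      refine IsBigO.trans (IsBigO.of_bound ‖u + v‖ (Eventually.of_forall fun y => ?_)) hδ4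
      rw [norm_mul, Complex.norm_real, mul_comm]
    have h4 := hO.trans (hwN.norm_left.pow 4)
    refine (((h1.trans h2).add h3).add h4).congr_left fun y => ?_
    rw [hfw, hTT, hL, hk]
    simp only [hwdef]
    push_cast
    ring
  have hx1 : (fun y => (x y : ℂ) - (a * w y + conj (a * w y))) =O[l] fun y => N y ^ 2 := hlin id hyN
  have hx2 : (fun y => (x' y : ℂ) - (a * lam * w y + conj (a * lam * w y))) =O[l]
      fun y => N y ^ 2 := by
    have h1 := hlin T' hTN'
    have hxN : (fun y => (x y : ℂ)) =O[l] N := by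
      refine IsBigO.of_bound 1 (Eventually.of_forall fun y => ?_)
      rw [one_mul, norm_norm, Complex.norm_real]
      exact norm_fst_le (y - (φ₀, α))
    have hxN' : (fun y => (x' y : ℂ)) =O[l] N :=
      (IsBigO.of_bound 1 (Eventually.of_forall fun y => by
        rw [one_mul, Complex.norm_real])).trans hO2
    have h2 : (fun y => w (T' y) - lam * w y) =O[l] fun y => N y ^ 2 := by
      have := (hmain.trans (isBigO_pow_of_tendsto_zero hN0 (j := 2) (by norm_num))).add
        ((((hxN.pow 3).add (hxN'.pow 3)).const_mul_left k).trans
          (isBigO_pow_of_tendsto_zero hN0 (j := 2) (by norm_num)))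
      exact this.congr_left fun y => by ring
    have h3 := h2.const_mul_left a
    have h4 : (fun y => conj (a * (w (T' y) - lam * w y))) =O[l] fun y => N y ^ 2 :=
      (IsBigO.of_bound 1 (Eventually.of_forall fun y => by
        rw [RCLike.norm_conj, one_mul])).trans h3
    refine (h1.add (h3.add h4)).congr_left fun y => ?_
    rw [hx'T]
    simp only [mul_sub, map_sub, ← mul_assoc]
    ring
  set τ : ℝ := 12 * ε * q * Complex.normSq a / (Γ.radius φ₀ * σ) with hτ
  have hRC : (Γ.radius φ₀ : ℂ) ≠ 0 := Complex.ofReal_ne_zero.2 hR0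
  have ha0 : a ≠ 0 := by
    rw [ha]
    refine div_ne_zero (Complex.ofReal_ne_zero.2 hq0) ?_
    exact mul_ne_zero (mul_ne_zero (mul_ne_zero two_ne_zero Complex.I_ne_zero) hσC) hv
  have hτ0 : τ ≠ 0 := by
    rw [hτ]
    refine div_ne_zero ?_ (mul_ne_zero hR0 hσ)
    exact mul_ne_zero (mul_ne_zero (mul_ne_zero (by norm_num) hε) hq0) (Complex.normSq_pos.2 ha0).ne'
  have hcoef : 3 * k * a ^ 2 * conj a * (1 + lam) = lam * (Complex.I * τ) := by
    have hσ2C : (σ : ℂ) ^ 2 = q * (2 - q) := by exact_mod_cast hσ2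
    -- The characteristic equation `lam ^ 2 - 2 * (q - 1) * lam + 1 = 0`; it makes the resonant
    -- coefficient a real multiple of `I * lam`.
    have h1 : (1 + lam) ^ 2 = 2 * q * lam := by
      rw [hlamq]
      linear_combination (σ : ℂ) ^ 2 * Complex.I_sq - hσ2C
    have h2 : a * (u + v) * (2 * Complex.I * σ) = 1 + lam := by
      have : a * (2 * Complex.I * σ * v) = q := by
        rw [ha]
        exact div_mul_cancel₀ _ (mul_ne_zero (mul_ne_zero (mul_ne_zero two_ne_zero Complex.I_ne_zero) hσC) hv)
      apply mul_right_cancel₀ hv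
      rw [hlamq]
      linear_combination (u + v) * this + huq
    have h3 : (τ : ℂ) * (Γ.radius φ₀ * σ) = 12 * ε * q * (a * conj a) := by
      rw [Complex.mul_conj, hτ]
      push_cast
      field_simp
    have h4 : k * Γ.radius φ₀ = -(4 * ε) * (u + v) := by
      rw [hk]
      push_cast
      field_simp
    have hne : (Γ.radius φ₀ : ℂ) * σ * (2 * Complex.I) ≠ 0 :=
      mul_ne_zero (mul_ne_zero hRC hσC) (mul_ne_zero two_ne_zero Complex.I_ne_zero)
    apply mul_right_cancel₀ hne
    have hI := Complex.I_sq
    linear_combination (3 * a ^ 2 * conj a * (1 + lam) * σ * (2 * Complex.I)) * h4 -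
      (12 * ε * a * conj a * (1 + lam)) * h2 - (12 * ε * a * conj a) * h1 -
      (lam * Complex.I * (2 * Complex.I)) * h3 - (24 * ε * q * a * conj a * lam) * hI
  have hw0 : Tendsto (fun y => ‖w y‖) l (𝓝 0) := by
    have := (hwN.trans_tendsto hN0).norm
    simpa using this
  obtain ⟨A, C, D, hnf⟩ := exists_birkhoff_normalForm hlam hlam2 hlam4 hw0 (hmain.trans (hww 4))
    (hx1.trans (hww 2)) (hx2.trans (hww 2)) hcoef
  refine ⟨τ, hτ0, ?_⟩
  -- The new chart is the old one preceded by the transition of canonical variables and followed by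
  -- `Φ`; both have identity derivative at the point.
  set Φ : ℂ → ℂ := fun z => z + complexCubic A 0 C D z with hΦ
  have hΦs : ContDiff ℝ ∞ Φ := contDiff_id.add contDiff_complexCubic
  have hΦd : HasFDerivAt Φ (ContinuousLinearMap.id ℝ ℂ) 0 := by
    refine ((hasFDerivAt_id (𝕜 := ℝ) (0 : ℂ)).add hasFDerivAt_complexCubic).congr_fderiv ?_
    rw [add_zero]
  have hJ := Γ.contDiff_canonicalTransition Γ'
  have hJc := Γ.canonicalTransition_canonical Γ'
  have hΨd : HasFDerivAt Ψ (fderiv ℝ Ψ (Γ.canonical (φ₀, α))) (Γ.canonical (φ₀, α)) :=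
    (hΨat.differentiableAt (by simp)).hasFDerivAt
  have hderiv : fderiv ℝ (fun p => Φ (Ψ (Γ.canonicalTransition Γ' p))) (Γ'.canonical (φ₀, α)) =
      fderiv ℝ Ψ (Γ.canonical (φ₀, α)) := by
    have h1 : HasFDerivAt (fun p => Ψ (Γ.canonicalTransition Γ' p)) _ (Γ'.canonical (φ₀, α)) :=
      HasFDerivAt.comp (Γ'.canonical (φ₀, α)) (by rw [hJc]; exact hΨd)
        (Γ.hasFDerivAt_canonicalTransition Γ' hR)
    have h2 : HasFDerivAt (fun p => Φ (Ψ (Γ.canonicalTransition Γ' p))) _ (Γ'.canonical (φ₀, α)) :=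
      HasFDerivAt.comp (Γ'.canonical (φ₀, α)) (by rw [hJc, hΨ0]; exact hΦd) h1
    rw [h2.fderiv]
    rfl
  refine ⟨Γ.canonicalTransition Γ' ⁻¹' U, fun p => Φ (Ψ (Γ.canonicalTransition Γ' p)), ζ,
    hU.preimage hJ.continuous, ?_, ?_, ?_, ?_, ?_⟩
  · rwa [mem_preimage, hJc]
  · exact hΦs.comp_contDiffOn (hΨ.comp hJ.contDiffOn fun p hp => hp)
  · simp only [hJc, hΨ0, hΦ, complexCubic_zero, add_zero]
  · rw [hderiv]; exact hdet
  · simp only [hJc]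
    refine hnf.trans ?_
    have hlittle : (fun y => complexCubic A 0 C D (w y)) =o[l] w := by
      have h1 : (fun y => complexCubic A 0 C D (w y)) =O[l] fun y => ‖w y‖ ^ 3 :=
        complexCubic_isBigO (isBigO_refl _ _).norm_right
      refine h1.trans_isLittleO ?_
      have h2 : (fun y => ‖w y‖ ^ 2 * ‖w y‖) =o[l] fun y => (1 : ℝ) * ‖w y‖ :=
        ((isLittleO_one_iff ℝ).2 (by simpa using hw0.pow 2)).mul_isBigO (isBigO_refl _ _)
      exact (h2.congr (fun y => by ring) fun y => one_mul _).of_norm_right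
    have h3 : w =O[l] fun y => Φ (w y) := hlittle.right_isBigO_add'
    exact h3.norm_norm.pow 4

end SymmetricOval

lemma isMultiplier_congr {F G : ℝ × ℝ → ℝ × ℝ} {x : ℝ × ℝ} (h : fderiv ℝ F x = fderiv ℝ G x) (μ : ℂ) :
    IsMultiplier F x μ ↔ IsMultiplier G x μ := by
  rw [IsMultiplier, IsMultiplier, h]

end

/-! ### Choice of the cut-off and of the size of the perturbation -/

theorem mainTheorem5 (n m : ℕ) (hm : 1 ≤ m) (hmn : m ≤ n - 1) (Γ : SymmetricOval n) (φ₀ : ℝ)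
    (hell : IsEllipticFixedPoint (Γ.quotientMap m) (φ₀, Real.pi * m / n))
    (hres : IsNonResonant (Γ.quotientMap m) (φ₀, Real.pi * m / n))
    (hτ : Γ.HasTwistCoefficient (Γ.quotientMap m) (φ₀, Real.pi * m / n) 0) :
    ∃ (δ₁ δ₂ : ℝ) (ρ : ℝ → ℝ), IsCutoff δ₁ δ₂ ρ ∧ δ₂ < Real.pi / n ∧
      (∀ φ : ℝ, 0 < |φ - φ₀| → |φ - φ₀| < δ₂ → deriv Γ.support φ ≠ 0) ∧
      ∀ (k : ℕ) (δ : ℝ), 0 < δ → ∃ ε₀ : ℝ, 0 < ε₀ ∧ ∀ ε : ℝ, 0 < |ε| → |ε| < ε₀ →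
        ∃ Γε : SymmetricOval n,
          (∀ φ : ℝ, |φ - φ₀| ≤ Real.pi / n →
            Γε.support φ = Γ.support φ + ε * (φ - φ₀) ^ 4 * ρ (φ - φ₀)) ∧
          SymmetricOval.CkClose k δ Γε Γ ∧
          IsEllipticFixedPoint (Γε.quotientMap m) (φ₀, Real.pi * m / n) ∧
          IsNonResonant (Γε.quotientMap m) (φ₀, Real.pi * m / n) ∧
          ∃ τ : ℝ, τ ≠ 0 ∧
            Γε.HasTwistCoefficient (Γε.quotientMap m) (φ₀, Real.pi * m / n) τ := by
  have hn0 : n ≠ 0 := by omega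
  have hn : (0 : ℝ) < n := Nat.cast_pos.2 (Nat.pos_of_ne_zero hn0)
  have hpos := Real.pi_pos
  set α : ℝ := Real.pi * m / n with hαdef
  have hα : m * (2 * Real.pi / n) = 2 * α := by rw [hαdef]; ring
  have h0 : 0 < α := div_pos (mul_pos hpos (Nat.cast_pos.2 hm)) hn
  have hpi : α < Real.pi := by
    have : (m : ℝ) < n := Nat.cast_lt.2 (by omega)
    rw [hαdef, div_lt_iff₀ hn]
    nlinarith
  have hfix := Γ.nextBounce_eq_of_fixed hα hell.2.1
  have hg2 : Γ.radius φ₀ - Γ.support φ₀ ≠ 0 :=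
    sub_ne_zero.2 (Γ.radius_ne_support_of_hasTwistCoefficient hα h0 hpi hfix hτ)
  set P : ℝ := 2 * Real.pi / n with hP
  have hP0 : 0 < P := by positivity
  have hPhalf : P / 2 = Real.pi / n := by rw [hP]; ring
  -- A nonzero derivative of `g'` at `φ₀` excludes zeros of `g'` in a punctured ball, whatever the
  -- value of `g'` at the centre.
  obtain ⟨r, hr, hball⟩ := Metric.mem_nhdsWithin_iff.1
    ((Γ.hasDerivAt_deriv_support φ₀).eventually_ne (c := 0) hg2)
  set δ₂ : ℝ := min r (P / 2) / 2 with hδ₂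
  have hmin : 0 < min r (P / 2) := lt_min hr (by positivity)
  have hδ₂0 : 0 < δ₂ := by positivity
  have hδ₂r : δ₂ < r := by linarith [min_le_left r (P / 2)]
  have hδ₂P : δ₂ < P / 2 := by linarith [min_le_right r (P / 2)]
  obtain ⟨ρ, hρ⟩ := exists_isCutoff (half_pos hδ₂0) (half_lt_self hδ₂0)
  refine ⟨δ₂ / 2, δ₂, ρ, hρ, hPhalf ▸ hδ₂P, fun φ hφ1 hφ2 => ?_, fun k δ hδ => ?_⟩
  · refine hball ⟨?_, ?_⟩
    · rw [Metric.mem_ball, Real.dist_eq]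
      exact hφ2.trans hδ₂r
    · rintro rfl
      simp at hφ1
  set f : ℝ → ℝ := fun x => x ^ 4 * ρ x with hf
  have hfs : ContDiff ℝ ∞ f := (contDiff_id.pow 4).mul hρ.smooth
  have hf0 : ∀ x, δ₂ < |x| → f x = 0 := fun x hx => by rw [hf]; simp only [hρ.eq_zero x hx, mul_zero]
  set H : ℝ → ℝ := fun φ => periodize P f (φ - φ₀) with hH
  have hHs : ContDiff ℝ ∞ H :=
    (contDiff_periodize hP0 hδ₂P hf0 hfs).comp (contDiff_id.sub contDiff_const)
  have hHp : Function.Periodic H P := (periodic_periodize hP0 f).sub_const φ₀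
  have hHnear : ∀ φ, |φ - φ₀| ≤ Real.pi / n → H φ = (φ - φ₀) ^ 4 * ρ (φ - φ₀) := by
    intro φ hφ
    have := periodize_eq hP0 hf0 (x := φ - φ₀) (k := 0) (by
      simp only [Int.cast_zero, zero_mul, sub_zero]; linarith)
    simpa [hH, hf] using this
  have hHloc : H =ᶠ[𝓝 φ₀] fun φ => (φ - φ₀) ^ 4 := by
    filter_upwards [Metric.ball_mem_nhds φ₀ (half_pos hδ₂0)] with φ hφ
    rw [Metric.mem_ball, Real.dist_eq] at hφ
    rw [hHnear φ (by linarith), hρ.eq_one _ hφ, mul_one]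
  have hHd := (contDiff_infty_iff_deriv.1 hHs).2
  have hHdd := (contDiff_infty_iff_deriv.1 hHd).2
  -- This keeps the radius of curvature at `φ₀`, as required for comparing the two sets of canonical
  -- variables.
  have hcurv : H φ₀ + deriv (deriv H) φ₀ = 0 := by
    have h1 : deriv H =ᶠ[𝓝 φ₀] fun φ => 4 * (φ - φ₀) ^ 3 := by
      filter_upwards [hHloc.eventuallyEq_nhds] with φ hφ
      have := ((hasDerivAt_id φ).sub_const φ₀).pow 4
      refine hφ.deriv_eq.trans (this.deriv.trans ?_)
      simp
    have h2 := (((hasDerivAt_id φ₀).sub_const φ₀).pow 3).const_mul 4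
    rw [hHloc.eq_of_nhds, h1.deriv_eq]
    refine (congrArg _ h2.deriv).trans ?_
    simp
  obtain ⟨c, hc0, hc⟩ := Γ.exists_pos_le_radius
  have hHpd : Function.Periodic (fun φ => H φ + deriv (deriv H) φ) P := by
    have := (hHp.iteratedDeriv 2)
    rw [iteratedDeriv_succ, iteratedDeriv_one] at this
    exact hHp.add this
  obtain ⟨B, hB0, hB⟩ := hHpd.exists_abs_le hP0.ne' (hHs.continuous.add hHdd.continuous)
  have hCj : ∀ j : ℕ, ∃ C, 0 < C ∧ ∀ x, |iteratedDeriv j H x| ≤ C := fun j =>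
    (hHp.iteratedDeriv j).exists_abs_le hP0.ne'
      (hHs.continuous_iteratedDeriv j (by exact_mod_cast le_top))
  choose C hC0 hC using hCj
  have hS0 : 0 < ∑ j ∈ Finset.range (k + 1), C j :=
    Finset.sum_pos (fun j _ => hC0 j) ⟨0, by simp⟩
  -- The first bound keeps the radius positive; in the second, the sum dominates each of the
  -- derivative bounds up to order `k`.
  refine ⟨min (c / B) (δ / ∑ j ∈ Finset.range (k + 1), C j), lt_min (by positivity) (by positivity),
    fun ε hε hεlt => ?_⟩
  have hε1 : |ε| * B < c := (lt_div_iff₀ hB0).1 (hεlt.trans_le (min_le_left _ _))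
  have hε2 : |ε| * ∑ j ∈ Finset.range (k + 1), C j < δ :=
    (lt_div_iff₀ hS0).1 (hεlt.trans_le (min_le_right _ _))
  set h : ℝ → ℝ := fun φ => ε * H φ with hh
  have hhs : ContDiff ℝ ∞ h := contDiff_const.mul hHs
  have hhp : Function.Periodic h P := fun φ => by simp only [hh, hHp φ]
  have hhd : ∀ φ, h φ + deriv (deriv h) φ = ε * (H φ + deriv (deriv H) φ) := fun φ => by
    have h1 : deriv h = fun φ => ε * deriv H φ := by
      funext φ
      exact deriv_const_mul _ (hHs.differentiable (by simp) φ)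
    rw [h1, deriv_const_mul _ (hHd.differentiable (by simp) φ)]
    simp only [hh]; ring
  have hrad : ∀ φ, 0 < Γ.radius φ + (h φ + deriv (deriv h) φ) := fun φ => by
    have h1 : |ε * (H φ + deriv (deriv H) φ)| < c := by
      rw [abs_mul]
      exact (mul_le_mul_of_nonneg_left (hB φ) (abs_nonneg ε)).trans_lt hε1
    rw [hhd]
    linarith [hc φ, neg_abs_le (ε * (H φ + deriv (deriv H) φ))]
  have hhloc : h =ᶠ[𝓝 φ₀] fun φ => ε * (φ - φ₀) ^ 4 := hHloc.mono fun φ hφ => by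
    simp only [hh, hφ]
  have hsupp := fun φ => Γ.support_perturb (hn := hn0) (hh := hhs) (hp := hhp) (hpos := hrad) φ
  have hradeq := Γ.radius_perturb (hn := hn0) (hh := hhs) (hp := hhp) (hpos := hrad) φ₀
  have hcurve := fun φ => Γ.curve_perturb (hn := hn0) (hh := hhs) (hp := hhp) (hpos := hrad) φ
  generalize Γ.perturb hn0 h hhs hhp hrad = Γε at hsupp hradeq hcurve
  rw [hhd, hcurv, mul_zero, add_zero] at hradeq
  have hder := Γ.hasFDerivAt_quotientMap_of_perturb hα h0 hpi hhp hhloc hcurve hfix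
  have hmult : ∀ μ, IsMultiplier (Γε.quotientMap m) (φ₀, α) μ ↔
      IsMultiplier (Γ.quotientMap m) (φ₀, α) μ := isMultiplier_congr hder.fderiv
  have hfixε := (Γ.nextBounce_sub_nextBounce_isBigO hα h0 hpi hhp hhloc hcurve hfix).1
  refine ⟨Γε, fun φ hφ => ?_, fun j hj φ => ?_, ⟨hder.differentiableAt, ?_, fun μ hμ => ?_⟩,
    fun μ hμ => ?_, ?_⟩
  · rw [hsupp, hh]
    simp only [hHnear φ hφ]
    ring
  · rw [funext hsupp]
    have h1 : iteratedDeriv j (fun φ => Γ.support φ + h φ) φ =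
        iteratedDeriv j Γ.support φ + ε * iteratedDeriv j H φ := by
      have := iteratedDeriv_add (x := φ) (n := j) (f := Γ.support) (g := h)
        (contDiff_infty.1 Γ.contDiff_support j).contDiffAt (contDiff_infty.1 hhs j).contDiffAt
      refine this.trans ?_
      rw [hh, iteratedDeriv_const_mul_field]
    rw [h1, add_sub_cancel_left, abs_mul]
    refine le_trans ?_ hε2.le
    refine mul_le_mul_of_nonneg_left ((hC j φ).trans ?_) (abs_nonneg ε)
    exact Finset.single_le_sum (fun i _ => (hC0 i).le) (Finset.mem_range.2 (by omega))
  · rw [Γε.quotientMap_eq hα, hfixε]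
    ext <;> simp; ring
  · exact hell.2.2 μ ((hmult μ).1 hμ)
  · exact hres μ ((hmult μ).1 hμ)
  · exact Γ.hasTwistCoefficient_of_perturb hα h0 hpi hhp hhloc (abs_pos.1 hε) hcurve hradeq hfix
      hres hτ
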